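/- For a finite simple graph $G$ with vertex set $V$, $|V|=n$, let $\mathbf{X}_G=\sum_\kappa\prod_{v\in V}x_{\kappa(v)}$ (sum over all proper colorings $\kappa:V\to\mathbb{N}$) be its chromatic symmetric function. Let $\mathfrak{st}_k=\mathbf{X}_{\mathsf{St}_k}$ be that of the star graph $\mathsf{St}_k$ on $k$ vertices, and for a partition $\lambda=(\lambda_1,\dots,\lambda_\ell)$ let $\mathfrak{st}_\lambda=\mathfrak{st}_{\lambda_1}\cdots\mathfrak{st}_{\lambda_\ell}$, $|\lambda|=\sum_i\lambda_i$ and $\ell(\lambda)=\ell$. There are unique rational coefficients $c_\lambda$ with $\mathbf{X}_G=\sum_{\lambda\vdash n}c_\lambda\mathfrak{st}_\lambda$ (the star-expansion), and the leading partition $\lambda_{\mathrm{lead}}$ of $\mathbf{X}_G$ is the lexicographically smallest partition $\lambda\vdash n$ with $c_\lambda\neq 0$. Let $G$ be a connected unicyclic graph, that is, a finite connected simple graph containing exactly one cycle $C$. For a vertex $v$ of $C$, the rooted tree at $v$ is the connected component of $v$ in the graph obtained from $G$ by deleting the edges of $C$; it is non-trivial if it has more than one vertex. A leaf is a vertex of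 degree one. Then the star-expansion and the leading partition $\lambda_{\mathrm{lead}}$ of $\mathbf{X}_G$ exist and are unique, and: 1. if exactly one of the rooted trees of $G$ is non-trivial, then the number of leaves of $G$ equals $|\lambda_{\mathrm{lead}}|-\ell(\lambda_{\mathrm{lead}})-1$; 2. if at least two of the rooted trees of $G$ are non-trivial, then the number of leaves of $G$ equals $|\lambda_{\mathrm{lead}}|-\ell(\lambda_{\mathrm{lead}})$. -/

import Mathlib

/-- The chromatic symmetric function `X_G = ∑_κ ∏_v x_{κ(v)}` (sum over all proper colorings
`κ : V → ℕ`), as a formal power series in the variables `x_0, x_1, x_2, …`: the coefficient of the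
monomial `x^d` is the (finite) number of proper colorings that use each color `i` exactly `d i`
times. -/
noncomputable def chromaticSymm {V : Type*} [Fintype V] (G : SimpleGraph V) :
    MvPowerSeries ℕ ℚ :=
  fun d => (Nat.card {κ : G.Coloring ℕ // ∑ v, Finsupp.single (κ v) 1 = d} : ℚ)

/-- The symmetric function `st_k = X_{St_k}` of the star graph on `k` vertices (with `st_0 = 1`). -/
noncomputable def starSymm : ℕ → MvPowerSeries ℕ ℚ
  | 0 => 1
  | k + 1 => chromaticSymm (SimpleGraph.starGraph (0 : Fin (k + 1)))

/-- The star-basis element `st_λ = st_{λ_1} st_{λ_2} ⋯ st_{λ_ℓ}`. -/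
noncomputable def starBasisElt {n : ℕ} (lam : n.Partition) : MvPowerSeries ℕ ℚ :=
  (lam.parts.map starSymm).prod

/-- `c` is the family of coefficients of a star-expansion `X_G = ∑_{λ ⊢ n} c_λ st_λ`. -/
def IsStarExpansion {V : Type*} [Fintype V] (G : SimpleGraph V)
    (c : (Fintype.card V).Partition → ℚ) : Prop :=
  chromaticSymm G = ∑ lam, c lam • starBasisElt lam

/-- Strict lexicographic order on partitions of `n`, the parts being listed in
non-increasing order. -/
def PartitionLexLT {n : ℕ} (mu lam : n.Partition) : Prop :=
  mu.parts.sort (· ≥ ·) < lam.parts.sort (· ≥ ·)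

/-- `lam` is the lexicographically smallest partition with a non-zero coefficient. -/
def IsLeadingPartition {n : ℕ} (c : n.Partition → ℚ) (lam : n.Partition) : Prop :=
  c lam ≠ 0 ∧ ∀ mu, c mu ≠ 0 → mu = lam ∨ PartitionLexLT lam mu

/-- The subgraph `C` of `G` is a cycle: it consists of the vertices and edges of a closed walk of
length at least three without repeated vertices. -/
def IsCycleSubgraph {V : Type*} {G : SimpleGraph V} (C : G.Subgraph) : Prop :=
  ∃ (u : V) (p : G.Walk u u), p.IsCycle ∧ p.toSubgraph = C

/-- A unicyclic graph contains exactly one cycle. -/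
def IsUnicyclic {V : Type*} (G : SimpleGraph V) : Prop :=
  ∃! C : G.Subgraph, IsCycleSubgraph C

/-- The vertex set of the rooted tree with root `v` that is attached to the cycle `C`: the
connected component of `v` once the edges of the cycle are removed. -/
def rootedTreeVerts {V : Type*} {G : SimpleGraph V} (C : G.Subgraph) (v : V) : Set V :=
  {w | (G.deleteEdges C.edgeSet).Reachable v w}

/-- The number of cycle vertices whose rooted tree is non-trivial (has more than one vertex). -/
noncomputable def numNontrivialTrees {V : Type*} {G : SimpleGraph V} (C : G.Subgraph) : ℕ :=
  {v ∈ C.verts | (rootedTreeVerts C v).Nontrivial}.ncard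

/-- The number of leaves, that is, of vertices of degree one. -/
noncomputable def numLeaves {V : Type*} (G : SimpleGraph V) : ℕ :=
  {v | (G.neighborSet v).ncard = 1}.ncard

section DelContr

variable {V : Type*}

/-- The equivalence relation generated by a single pair. -/
def pairSetoid (u v : V) : Setoid V := Relation.EqvGen.setoid fun a b => a = u ∧ b = v

theorem pairSetoid_le_iff {u v : V} {r : Setoid V} : pairSetoid u v ≤ r ↔ r u v := by
  refine (Setoid.gi.gc _ _).trans ⟨fun h => h u v ⟨rfl, rfl⟩, ?_⟩
  rintro h a b ⟨rfl, rfl⟩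
  exact h

theorem sup_pairSetoid_le_iff {u v : V} {r s : Setoid V} :
    r ⊔ pairSetoid u v ≤ s ↔ r ≤ s ∧ s u v := by
  rw [sup_le_iff, pairSetoid_le_iff]

theorem pairSetoid_self (u : V) : pairSetoid u u = ⊥ :=
  le_bot_iff.1 (pairSetoid_le_iff.2 rfl)

/-- Deletion–contraction along a list of edges, starting from a weight on set partitions. -/
def delContr {S : Type*} [Sub S] (w : Setoid V → S) : List (V × V) → Setoid V → S
  | [], r => w r
  | e :: es, r => delContr w es r - delContr w es (r ⊔ pairSetoid e.1 e.2)

section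
variable {S : Type*} [AddCommGroup S]

theorem delContr_sup (w : Setoid V → S) (es : List (V × V)) (r s : Setoid V) :
    delContr w es (r ⊔ s) = delContr (fun r => w (r ⊔ s)) es r := by
  induction es generalizing r with
  | nil => rfl
  | cons e es ih =>
    simp only [delContr]
    rw [ih, sup_right_comm, ih]

theorem delContr_sub (w₁ w₂ : Setoid V → S) (es : List (V × V)) (r : Setoid V) :
    delContr (fun r => w₁ r - w₂ r) es r = delContr w₁ es r - delContr w₂ es r := by
  induction es generalizing r with
  | nil => rfl
  | cons e es ih =>
    simp only [delContr, ih]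
    abel

theorem delContr_cons (w : Setoid V → S) (e : V × V) (es : List (V × V)) (r : Setoid V) :
    delContr w (e :: es) r = delContr (fun r => w r - w (r ⊔ pairSetoid e.1 e.2)) es r := by
  rw [delContr_sub, ← delContr_sup]
  rfl

theorem delContr_perm (w : Setoid V → S) {es fs : List (V × V)} (h : es.Perm fs) (r : Setoid V) :
    delContr w es r = delContr w fs r := by
  induction h generalizing r with
  | nil => rfl
  | cons e _ ih => simp only [delContr, ih]
  | swap e f es =>
    simp only [delContr]
    rw [sup_right_comm]
    abel
  | trans _ _ ih₁ ih₂ => rw [ih₁, ih₂]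

theorem delContr_congr {w₁ w₂ : Setoid V → S} (P : Setoid V → Prop) {es : List (V × V)}
    (hP : ∀ e ∈ es, ∀ r, P r → P (r ⊔ pairSetoid e.1 e.2)) (hw : ∀ r, P r → w₁ r = w₂ r)
    {r : Setoid V} (hr : P r) : delContr w₁ es r = delContr w₂ es r := by
  induction es generalizing r with
  | nil => exact hw r hr
  | cons e es ih =>
    have ih' := fun {r} hr => ih (fun f hf => hP f (List.mem_cons_of_mem _ hf)) (r := r) hr
    simp only [delContr]
    rw [ih' hr, ih' (hP e List.mem_cons_self r hr)]

theorem delContr_loop (w : Setoid V → S) (u : V) (es : List (V × V)) (r : Setoid V) :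
    delContr w ((u, u) :: es) r = 0 := by
  simp [delContr, pairSetoid_self]

/-- A relation between weights that is stable under subtraction passes to `delContr`. -/
theorem delContr_rel {T : Type*} [AddCommGroup T] {w₁ : Setoid V → S} {w₂ : Setoid V → T}
    (Q : S → T → Prop) (hsub : ∀ a b c d, Q a c → Q b d → Q (a - b) (c - d))
    (hw : ∀ r, Q (w₁ r) (w₂ r)) (es : List (V × V)) (r : Setoid V) :
    Q (delContr w₁ es r) (delContr w₂ es r) := by
  induction es generalizing r with
  | nil => exact hw r
  | cons e es ih => exact hsub _ _ _ _ (ih _) (ih _)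

end

/-- `u` is alone in its class. -/
def IsolatedIn (u : V) (r : Setoid V) : Prop := ∀ x, r u x → x = u

theorem isolatedIn_bot (u : V) : IsolatedIn u ⊥ := fun _ h => h.symm

theorem IsolatedIn.sup_pair {u a b : V} {r : Setoid V} (h : IsolatedIn u r) (ha : a ≠ u)
    (hb : b ≠ u) : IsolatedIn u (r ⊔ pairSetoid a b) := by
  have : r ⊔ pairSetoid a b ≤ Setoid.ker (fun x => x = u) := by
    rw [sup_pairSetoid_le_iff]
    refine ⟨fun x y hxy => ?_, ?_⟩
    · simp only [Setoid.ker_def, eq_iff_iff]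
      constructor
      · rintro rfl
        exact h _ hxy
      · rintro rfl
        exact h _ (r.symm hxy)
    · simp [Setoid.ker_def, ha, hb]
  intro x hx
  simpa [Setoid.ker_def] using this hx

open Classical in
theorem sup_pairSetoid_rel_iff {u v : V} {r : Setoid V} (h : IsolatedIn u r) (huv : v ≠ u)
    (a b : V) : (r ⊔ pairSetoid u v) a b ↔
      r (if a = u then v else a) (if b = u then v else b) := by
  constructor
  · have : r ⊔ pairSetoid u v ≤ Setoid.comap (fun a => if a = u then v else a) r := by
      rw [sup_pairSetoid_le_iff]
      refine ⟨fun x y hxy => ?_, ?_⟩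
      · rw [Setoid.comap_rel]
        by_cases hx : x = u
        · subst hx
          rw [h _ hxy]
        · have hy : y ≠ u := fun hy => hx (by subst hy; exact h _ (r.symm hxy))
          simpa [hx, hy] using hxy
      · rw [Setoid.comap_rel]
        simp [huv]
    intro hab
    exact this hab
  · intro hab
    have key : ∀ x, (r ⊔ pairSetoid u v) x (if x = u then v else x) := by
      intro x
      split_ifs with hx
      · subst hx
        exact (sup_pairSetoid_le_iff.1 le_rfl).2
      · exact Setoid.refl' _ _
    exact Setoid.trans' _ (key a) (Setoid.trans' _
      ((le_sup_left : r ≤ r ⊔ pairSetoid u v) hab) (Setoid.symm' _ (key b)))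

section
variable {R : Type*} [CommRing R] [DecidableEq V]

theorem prod_update_update {u v : V} {K : Finset V} (hu : u ∉ K) (hv : v ∈ K) (z : V → R)
    (a η : R) : ∏ x ∈ K, Function.update (Function.update z v (z v * a)) u η x
      = (∏ x ∈ K, z x) * a := by
  rw [Finset.prod_congr rfl fun x hx => Function.update_of_ne (ne_of_mem_of_not_mem hx hu) _ _,
    Finset.prod_update_of_mem hv, ← Finset.mul_prod_erase K z hv, Finset.sdiff_singleton_eq_erase]
  ring

theorem prod_update_update_of_notMem {u v : V} {K : Finset V} (hu : u ∉ K) (hv : v ∉ K) (z : V → R)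
    (a η : R) : ∏ x ∈ K, Function.update (Function.update z v a) u η x = ∏ x ∈ K, z x := by
  refine Finset.prod_congr rfl fun x hx => ?_
  rw [Function.update_of_ne (ne_of_mem_of_not_mem hx hu),
    Function.update_of_ne (ne_of_mem_of_not_mem hx hv)]

end

section Blocks
variable [Fintype V]

open Classical in
/-- The classes of an equivalence relation. -/
noncomputable def blocks (r : Setoid V) : Finset (Finset V) :=
  Finset.univ.image fun v => Finset.univ.filter fun x => r v x

open Classical in
/-- The class of `v`. -/
noncomputable def block (r : Setoid V) (v : V) : Finset V := Finset.univ.filter fun x => r v x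

theorem mem_block {r : Setoid V} {v x : V} : x ∈ block r v ↔ r v x := by
  classical
  simp [block]

theorem mem_blocks {r : Setoid V} {K : Finset V} : K ∈ blocks r ↔ ∃ v, block r v = K := by
  classical
  simp [blocks, block]

theorem block_eq_of_mem {r : Setoid V} {v x : V} (h : r v x) : block r v = block r x := by
  ext y
  simp only [mem_block]
  exact ⟨fun h' => r.trans (r.symm h) h', fun h' => r.trans h h'⟩

theorem block_isolated {u : V} {r : Setoid V} (h : IsolatedIn u r) : block r u = {u} := by
  ext y
  simp only [mem_block, Finset.mem_singleton]
  exact ⟨fun h' => h _ h', fun h' => h' ▸ r.refl u⟩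

theorem block_nonempty (r : Setoid V) (v : V) : (block r v).Nonempty := ⟨v, mem_block.2 (r.refl v)⟩

@[to_additive]
theorem prod_blocks {M : Type*} [CommMonoid M] (r : Setoid V) (f : V → M) :
    ∏ K ∈ blocks r, ∏ v ∈ K, f v = ∏ v, f v := by
  classical
  rw [← Finset.prod_biUnion]
  · congr 1
    ext v
    simp only [Finset.mem_biUnion, Finset.mem_univ, iff_true]
    exact ⟨block r v, mem_blocks.2 ⟨v, rfl⟩, mem_block.2 (r.refl v)⟩
  · intro K hK K' hK' hne
    obtain ⟨v, rfl⟩ := mem_blocks.1 hK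
    obtain ⟨v', rfl⟩ := mem_blocks.1 hK'
    refine Finset.disjoint_left.2 fun x hx hx' => hne ?_
    rw [block_eq_of_mem (mem_block.1 hx), block_eq_of_mem (mem_block.1 hx')]

variable {S R : Type*} [CommRing S] [CommRing R] [Algebra S R]

/-- The multiplicative weight of a set partition attached to vertex weights `z`. -/
noncomputable def blockWeight (φ : R →ₗ[S] S) (z : V → R) (r : Setoid V) : S :=
  ∏ K ∈ blocks r, φ (∏ v ∈ K, z v)

theorem exists_blocks_decomp {u v : V} {r : Setoid V} (h : IsolatedIn u r) (huv : v ≠ u) :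
    ∃ rest : Finset (Finset V), (∀ K ∈ rest, u ∉ K ∧ v ∉ K) ∧ u ∉ block r v ∧ v ∈ block r v ∧
      (∀ f : Finset V → S, ∏ K ∈ blocks r, f K = f {u} * f (block r v) * ∏ K ∈ rest, f K) ∧
      (∀ f : Finset V → S, ∏ K ∈ blocks (r ⊔ pairSetoid u v), f K =
        f (Finset.cons u (block r v) (fun hu => huv (h _ (r.symm (mem_block.1 hu)))))
          * ∏ K ∈ rest, f K) := by
  classical
  have hu : u ∉ block r v := fun hu => huv (h _ (r.symm (mem_block.1 hu)))
  have hv : v ∈ block r v := mem_block.2 (r.refl v)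
  have hne : ({u} : Finset V) ≠ block r v := fun e => hu (e ▸ Finset.mem_singleton_self u)
  have hrest : ∀ K ∈ ((blocks r).erase {u}).erase (block r v), u ∉ K ∧ v ∉ K := by
    intro K hK
    simp only [Finset.mem_erase] at hK
    obtain ⟨h1, h2, h3⟩ := hK
    obtain ⟨x, rfl⟩ := mem_blocks.1 h3
    refine ⟨fun hx => h2 ?_, fun hx => h1 (block_eq_of_mem (mem_block.1 hx))⟩
    rw [block_eq_of_mem (mem_block.1 hx), block_isolated h]
  refine ⟨((blocks r).erase {u}).erase (block r v), hrest, hu, hv, fun f => ?_, fun f => ?_⟩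
  · rw [mul_assoc, Finset.mul_prod_erase (a := block r v), Finset.mul_prod_erase]
    · exact mem_blocks.2 ⟨u, block_isolated h⟩
    · exact Finset.mem_erase.2 ⟨hne.symm, mem_blocks.2 ⟨v, rfl⟩⟩
  · rw [← Finset.prod_insert (a := Finset.cons u (block r v) hu)]
    · congr 1
      have e1 : ∀ a, (a = u ∨ r v a) →
          block (r ⊔ pairSetoid u v) a = Finset.cons u (block r v) hu := by
        intro a ha
        ext b
        rw [mem_block, sup_pairSetoid_rel_iff h huv, Finset.mem_cons, mem_block]
        have ha' : r v (if a = u then v else a) := by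
          split_ifs with hau
          · exact r.refl v
          · exact ha.resolve_left hau
        by_cases hb : b = u
        · simp only [hb, if_true, true_or, iff_true]
          exact r.symm ha'
        · simp only [hb, if_false, false_or]
          exact ⟨fun h' => r.trans ha' h', fun h' => r.trans (r.symm ha') h'⟩
      have e2 : ∀ a, ¬ (a = u ∨ r v a) → block (r ⊔ pairSetoid u v) a = block r a := by
        intro a ha
        push Not at ha
        ext b
        rw [mem_block, sup_pairSetoid_rel_iff h huv, mem_block, if_neg ha.1]
        split_ifs with hb
        · subst hb
          exact ⟨fun h' => absurd (r.symm h') ha.2, fun h' => absurd (h _ (r.symm h')) ha.1⟩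
        · rfl
      ext K
      simp only [Finset.mem_insert, Finset.mem_erase, mem_blocks]
      constructor
      · rintro ⟨a, rfl⟩
        by_cases ha : a = u ∨ r v a
        · exact Or.inl (e1 a ha)
        · rw [e2 a ha]
          refine Or.inr ⟨fun h' => ha (Or.inr ?_), fun h' => ha (Or.inl ?_), a, rfl⟩
          · rw [← mem_block, ← h', mem_block]
          · rw [← Finset.mem_singleton, ← h', mem_block]
      · rintro (rfl | ⟨h1, h2, a, rfl⟩)
        · exact ⟨u, e1 u (Or.inl rfl)⟩
        · refine ⟨a, e2 a ?_⟩
          rintro (rfl | h')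
          · exact h2 (block_isolated h)
          · exact h1 (block_eq_of_mem h').symm
    · intro hK
      exact (hrest _ hK).1 (Finset.mem_cons_self _ _)

variable [DecidableEq V]

theorem blockWeight_sup_pair (φ : R →ₗ[S] S) (z : V → R) {u v : V} {r : Setoid V} {η : R}
    (hη : φ η = 1) (h : IsolatedIn u r) (huv : v ≠ u) :
    blockWeight φ z (r ⊔ pairSetoid u v) =
      blockWeight φ (Function.update (Function.update z v (z v * z u)) u η) r := by
  obtain ⟨rest, h1, h2, h3, h4, h5⟩ := exists_blocks_decomp (S := S) h huv
  unfold blockWeight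
  rw [h4, h5, prod_update_update h2 h3, Finset.prod_cons, Finset.prod_singleton,
    Function.update_self, hη, one_mul, mul_comm (z u)]
  congr 1
  refine Finset.prod_congr rfl fun K hK => ?_
  rw [prod_update_update_of_notMem (h1 K hK).1 (h1 K hK).2]

theorem blockWeight_sub_sup_pair (φ : R →ₗ[S] S) (z : V → R) {u v : V} {r : Setoid V} {η : R}
    (hη : φ η = 1) (h : IsolatedIn u r) (huv : v ≠ u) :
    blockWeight φ z r - blockWeight φ z (r ⊔ pairSetoid u v) =
      blockWeight φ (Function.update (Function.update z v
        (z v * (algebraMap S R (φ (z u)) - z u))) u η) r := by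
  obtain ⟨rest, h1, h2, h3, h4, h5⟩ := exists_blocks_decomp (S := S) h huv
  unfold blockWeight
  rw [h4, h4, h5, prod_update_update h2 h3, Finset.prod_cons, Finset.prod_singleton,
    Finset.prod_singleton, Function.update_self, hη, one_mul, ← sub_mul, mul_sub, map_sub,
    mul_comm _ (algebraMap S R _), ← Algebra.smul_def, map_smul, smul_eq_mul, mul_comm (z u)]
  congr 1
  refine Finset.prod_congr rfl fun K hK => ?_
  rw [prod_update_update_of_notMem (h1 K hK).1 (h1 K hK).2]

/-- A pendant edge can be removed at the cost of changing the weight of its inner vertex. -/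
theorem delContr_peel (φ : R →ₗ[S] S) (z : V → R) {u v : V} {η : R} (hη : φ η = 1)
    {es : List (V × V)} (hes : ∀ e ∈ es, e.1 ≠ u ∧ e.2 ≠ u) (huv : v ≠ u) :
    delContr (blockWeight φ z) ((u, v) :: es) ⊥ =
      delContr (blockWeight φ (Function.update (Function.update z v
        (z v * (algebraMap S R (φ (z u)) - z u))) u η)) es ⊥ := by
  rw [delContr_cons]
  exact delContr_congr (IsolatedIn u) (fun e he r hr => hr.sup_pair (hes e he).1 (hes e he).2)
    (fun r hr => blockWeight_sub_sup_pair φ z hη hr huv) (isolatedIn_bot u)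

/-- Contraction of a vertex that meets no further edges. -/
theorem delContr_contract (φ : R →ₗ[S] S) (z : V → R) {u v : V} {η : R} (hη : φ η = 1)
    {es : List (V × V)} (hes : ∀ e ∈ es, e.1 ≠ u ∧ e.2 ≠ u) (huv : v ≠ u) :
    delContr (blockWeight φ z) es (⊥ ⊔ pairSetoid u v) =
      delContr (blockWeight φ (Function.update (Function.update z v (z v * z u)) u η)) es ⊥ := by
  rw [delContr_sup]
  exact delContr_congr (IsolatedIn u) (fun e he r hr => hr.sup_pair (hes e he).1 (hes e he).2)
    (fun r hr => blockWeight_sup_pair φ z hη hr huv) (isolatedIn_bot u)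

end Blocks
end DelContr

section CycleValue

variable {V : Type*}

/-- The edges of the path along a list of vertices. -/
def chainPairs : List V → List (V × V)
  | [] => []
  | [_] => []
  | a :: b :: l => (a, b) :: chainPairs (b :: l)

/-- The edges of the cycle along the vertices of `l` followed by `w`. -/
def cyclePairs (w : V) : List V → List (V × V)
  | [] => [(w, w)]
  | a :: l => (a, w) :: chainPairs (a :: (l ++ [w]))

theorem mem_of_mem_chainPairs {l : List V} {e : V × V} (h : e ∈ chainPairs l) :
    e.1 ∈ l ∧ e.2 ∈ l := by
  induction l with
  | nil => simp [chainPairs] at h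
  | cons a l ih =>
    cases l with
    | nil => simp [chainPairs] at h
    | cons b l =>
      rw [chainPairs, List.mem_cons] at h
      rcases h with rfl | h
      · simp
      · exact ⟨List.mem_cons_of_mem _ (ih h).1, List.mem_cons_of_mem _ (ih h).2⟩

theorem mem_of_mem_cyclePairs {w : V} {l : List V} {e : V × V} (h : e ∈ cyclePairs w l) :
    e.1 ∈ l ++ [w] ∧ e.2 ∈ l ++ [w] := by
  cases l with
  | nil => simp_all [cyclePairs]
  | cons a l =>
    rw [cyclePairs, List.mem_cons] at h
    rcases h with rfl | h
    · simp
    · exact mem_of_mem_chainPairs h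

variable {S R : Type*} [CommRing S] [CommRing R] [Algebra S R]

/-- The value of a weighted path. -/
def pathValue (φ : R →ₗ[S] S) : R → List R → S
  | x, [] => φ x
  | x, y :: l => pathValue φ (y * (algebraMap S R (φ x) - x)) l

/-- The value of a weighted cycle. -/
def cycleValue (φ : R →ₗ[S] S) : R → List R → S
  | _, [] => 0
  | x, y :: l => pathValue φ y (l ++ [x]) - cycleValue φ (x * y) l

theorem pairSetoid_comm (u v : V) : pairSetoid u v = pairSetoid v u :=
  le_antisymm (pairSetoid_le_iff.2 (Setoid.symm' _ (pairSetoid_le_iff.1 le_rfl)))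
    (pairSetoid_le_iff.2 (Setoid.symm' _ (pairSetoid_le_iff.1 le_rfl)))

theorem sup_pairSetoid_slide (r : Setoid V) (a w b : V) :
    r ⊔ pairSetoid a w ⊔ pairSetoid a b = r ⊔ pairSetoid a w ⊔ pairSetoid w b := by
  have aux : ∀ a w b : V, r ⊔ pairSetoid a w ⊔ pairSetoid a b ≤
      r ⊔ pairSetoid a w ⊔ pairSetoid w b := by
    intro a w b
    rw [sup_pairSetoid_le_iff]
    refine ⟨le_sup_left, ?_⟩
    have h1 := (sup_pairSetoid_le_iff.1
      (le_sup_left : r ⊔ pairSetoid a w ≤ r ⊔ pairSetoid a w ⊔ pairSetoid w b)).2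
    have h2 := (sup_pairSetoid_le_iff.1 (le_refl (r ⊔ pairSetoid a w ⊔ pairSetoid w b))).2
    exact Setoid.trans' _ h1 h2
  refine le_antisymm (aux a w b) ?_
  rw [pairSetoid_comm a w]
  exact aux w a b

variable [Fintype V]

theorem block_bot (v : V) : block (⊥ : Setoid V) v = {v} := block_isolated (isolatedIn_bot v)

theorem blockWeight_bot (φ : R →ₗ[S] S) (z : V → R) : blockWeight φ z ⊥ = ∏ v, φ (z v) := by
  classical
  have : blocks (⊥ : Setoid V) = Finset.univ.map ⟨fun v => ({v} : Finset V),
      Finset.singleton_injective⟩ := by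
    ext K
    simp [mem_blocks, block_bot]
  rw [blockWeight, this, Finset.prod_map]
  simp

theorem delContr_chainPairs (φ : R →ₗ[S] S) {η : R} (hη : φ η = 1) (a : V) (l : List V)
    (z : V → R) (hnd : (a :: l).Nodup) (hz : ∀ v ∉ a :: l, φ (z v) = 1) :
    delContr (blockWeight φ z) (chainPairs (a :: l)) ⊥ = pathValue φ (z a) (l.map z) := by
  classical
  induction l generalizing a z with
  | nil =>
    rw [chainPairs, delContr, blockWeight_bot, List.map_nil, pathValue]
    exact Finset.prod_eq_single a (fun v _ hv => hz v (by simpa using hv)) (by simp)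
  | cons b l ih =>
    obtain ⟨ha, hnd'⟩ := List.nodup_cons.1 hnd
    have hba : b ≠ a := fun h => ha (h ▸ List.mem_cons_self)
    have hne : ∀ x ∈ b :: l, x ≠ a := fun x hx => ne_of_mem_of_not_mem hx ha
    rw [chainPairs, delContr_peel φ z hη _ hba, ih b _ hnd']
    · rw [List.map_cons, pathValue, Function.update_of_ne hba, Function.update_self]
      congr 1
      refine List.map_congr_left fun x hx => ?_
      rw [Function.update_of_ne (hne x (List.mem_cons_of_mem _ hx)), Function.update_of_ne
        (ne_of_mem_of_not_mem hx (List.nodup_cons.1 hnd').1)]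
    · intro v hv
      by_cases hva : v = a
      · rw [hva, Function.update_self, hη]
      · rw [Function.update_of_ne hva,
          Function.update_of_ne (fun h => hv (by simp [h]))]
        exact hz v (by simp only [List.mem_cons] at hv ⊢; tauto)
    · exact fun e he => ⟨hne _ (mem_of_mem_chainPairs he).1, hne _ (mem_of_mem_chainPairs he).2⟩

theorem delContr_cyclePairs (φ : R →ₗ[S] S) {η : R} (hη : φ η = 1) (w : V) (l : List V)
    (z : V → R) (hnd : (l ++ [w]).Nodup) (hz : ∀ v ∉ l ++ [w], φ (z v) = 1) :
    delContr (blockWeight φ z) (cyclePairs w l) ⊥ = cycleValue φ (z w) (l.map z) := by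
  classical
  induction l generalizing z with
  | nil => rw [cyclePairs, delContr_loop, List.map_nil, cycleValue]
  | cons a l ih =>
    rw [List.cons_append] at hnd hz
    obtain ⟨ha, hnd'⟩ := List.nodup_cons.1 hnd
    have hne : ∀ x ∈ l ++ [w], x ≠ a := fun x hx => ne_of_mem_of_not_mem hx ha
    have hwa : w ≠ a := hne w (by simp)
    have hwl : ∀ x ∈ l, x ≠ w := by
      intro x hx h
      rw [List.nodup_append] at hnd'
      exact hnd'.2.2 x hx w (by simp) h
    have key : delContr (blockWeight φ z) (chainPairs (a :: (l ++ [w]))) (⊥ ⊔ pairSetoid a w) =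
        delContr (blockWeight φ z) (cyclePairs w l) (⊥ ⊔ pairSetoid a w) := by
      cases l with
      | nil =>
        simp only [List.nil_append, chainPairs, cyclePairs, delContr]
        rw [sup_pairSetoid_slide]
      | cons b l =>
        simp only [List.cons_append, chainPairs, cyclePairs, delContr]
        rw [sup_pairSetoid_slide, pairSetoid_comm b w]
    rw [cyclePairs, delContr, delContr_chainPairs φ hη a _ z hnd hz, key,
      delContr_contract φ z hη _ hwa, ih _ hnd']
    · rw [List.map_cons, cycleValue, List.map_append, Function.update_of_ne hwa,
        Function.update_self]
      congr 2
      refine List.map_congr_left fun x hx => ?_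
      rw [Function.update_of_ne (hne x (by simp [hx])), Function.update_of_ne (hwl x hx)]
    · intro v hv
      by_cases hva : v = a
      · rw [hva, Function.update_self, hη]
      · rw [Function.update_of_ne hva, Function.update_of_ne (fun h => hv (by simp [h]))]
        exact hz v (by simp only [List.mem_cons] at hv ⊢; tauto)
    · exact fun e he => ⟨hne _ (mem_of_mem_cyclePairs he).1, hne _ (mem_of_mem_cyclePairs he).2⟩

end CycleValue

section NilpotentModel

/-- First-order deformations `c₀ + c₁ t` with `t ^ 2 = 0`. -/
abbrev DefBase := DualNumber ℚ

/-- Elements `b + a ε + d δ`, with all products of `ε` and `δ` equal to zero. -/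
abbrev DefRing := TrivSqZeroExt DefBase (DefBase × DefBase)

/-- The functional with `1 ↦ 1 - t`, `ε ↦ 1`, `δ ↦ t`. -/
noncomputable def defFunctional : DefRing →ₗ[DefBase] DefBase where
  toFun x := (1 - DualNumber.eps) * x.fst + x.snd.1 + DualNumber.eps * x.snd.2
  map_add' x y := by
    simp only [TrivSqZeroExt.fst_add, TrivSqZeroExt.snd_add, Prod.fst_add, Prod.snd_add]
    ring
  map_smul' c x := by
    simp only [TrivSqZeroExt.fst_smul, TrivSqZeroExt.snd_smul, Prod.smul_fst, Prod.smul_snd,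
      smul_eq_mul, RingHom.id_apply]
    ring

/-- The coefficient of `1`, modulo `t`. -/
def constPart (x : DefRing) : ℚ := x.fst.fst

/-- The coefficient of `ε`, modulo `t`. -/
def epsPart (x : DefRing) : ℚ := x.snd.1.fst

theorem constPart_mul (x y : DefRing) : constPart (x * y) = constPart x * constPart y := by
  simp [constPart]

theorem epsPart_mul (x y : DefRing) :
    epsPart (x * y) = constPart x * epsPart y + constPart y * epsPart x := by
  simp [constPart, epsPart]

theorem fst_defFunctional (x : DefRing) : (defFunctional x).fst = constPart x + epsPart x := by
  simp [defFunctional, constPart, epsPart]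

theorem constPart_peel (x : DefRing) :
    constPart (algebraMap DefBase DefRing (defFunctional x) - x) = epsPart x := by
  have := fst_defFunctional x
  simp only [constPart, epsPart, TrivSqZeroExt.algebraMap_eq_inl, TrivSqZeroExt.fst_sub,
    TrivSqZeroExt.fst_inl] at this ⊢
  linarith

theorem epsPart_peel (x : DefRing) :
    epsPart (algebraMap DefBase DefRing (defFunctional x) - x) = - epsPart x := by
  simp [epsPart, TrivSqZeroExt.algebraMap_eq_inl]

/-- The character-like quantity governing a vertex of the cycle. -/
def cycleChar (x : DefRing) : ℚ := epsPart x - constPart x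

theorem fst_pathValue (x w : DefRing) (l : List DefRing) :
    (pathValue (S := DefBase) defFunctional x (l ++ [w])).fst =
      epsPart x * (l.map cycleChar).prod * epsPart w := by
  induction l generalizing x with
  | nil =>
    simp only [List.nil_append, pathValue, fst_defFunctional, constPart_mul, epsPart_mul,
      constPart_peel, epsPart_peel, List.map_nil, List.prod_nil]
    ring
  | cons y l ih =>
    rw [List.cons_append, pathValue, ih, epsPart_mul, constPart_peel, epsPart_peel, List.map_cons,
      List.prod_cons, cycleChar]
    ring

theorem fst_cycleValue (w : DefRing) (l : List DefRing) :
    (cycleValue (S := DefBase) defFunctional w l).fst =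
      cycleChar w * (l.map cycleChar).prod + (-1) ^ (l.length + 1) * cycleChar (w * l.prod) := by
  induction l generalizing w with
  | nil => simp [cycleValue]
  | cons y l ih =>
    rw [cycleValue, TrivSqZeroExt.fst_sub, fst_pathValue, ih, List.map_cons, List.prod_cons,
      List.prod_cons, List.length_cons, ← mul_assoc, pow_succ (-1 : ℚ) (l.length + 1)]
    have : cycleChar (w * y) = epsPart y * epsPart w - cycleChar w * cycleChar y := by
      simp only [cycleChar, epsPart_mul, constPart_mul]
      ring
    rw [this]
    ring_nf

/-- The weight `1 + δ` of a deep vertex. -/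
def deepWeight : DefRing := TrivSqZeroExt.inl 1 + TrivSqZeroExt.inr (0, 1)

theorem defFunctional_deepWeight : defFunctional deepWeight = 1 := by
  simp [defFunctional, deepWeight]

theorem DefRing.ext' {x y : DefRing} (h1 : x.fst = y.fst) (h2 : x.snd.1 = y.snd.1)
    (h3 : x.snd.2 = y.snd.2) : x = y :=
  TrivSqZeroExt.ext h1 (Prod.ext h2 h3)

theorem defFunctional_eq_zero {c n : ℚ} {x : DefRing}
    (h1 : x.fst = c • DualNumber.eps) (h2 : x.snd.1 = 0)
    (h3 : x.snd.2 = n • DualNumber.eps - TrivSqZeroExt.inl c) : defFunctional x = 0 := by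
  refine TrivSqZeroExt.ext ?_ ?_ <;> simp [defFunctional, h1, h2, h3]

theorem pathValue_tail (c n : ℚ) (j : ℕ) (w x : DefRing)
    (h1 : x.fst = c • DualNumber.eps) (h2 : x.snd.1 = 0)
    (h3 : x.snd.2 = n • DualNumber.eps - TrivSqZeroExt.inl c) :
    pathValue (S := DefBase) defFunctional x (List.replicate j deepWeight ++ [w]) =
      ((-1) ^ (j + 1) * c * epsPart w) • DualNumber.eps := by
  induction j generalizing c n x with
  | zero =>
    rw [List.replicate_zero, List.nil_append, pathValue, defFunctional_eq_zero h1 h2 h3, pathValue]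
    refine TrivSqZeroExt.ext ?_ ?_ <;> simp [defFunctional, h1, h2, h3, epsPart]
    ring
  | succ j ih =>
    rw [List.replicate_succ, List.cons_append, pathValue, defFunctional_eq_zero h1 h2 h3]
    have e1 : (deepWeight * (algebraMap DefBase DefRing 0 - x)).fst =
        (-c) • (DualNumber.eps : DefBase) := by
      refine TrivSqZeroExt.ext ?_ ?_ <;> simp [deepWeight, h1]
    have e2 : (deepWeight * (algebraMap DefBase DefRing 0 - x)).snd.1 = 0 := by
      simp [deepWeight, h2]
    have e3 : (deepWeight * (algebraMap DefBase DefRing 0 - x)).snd.2 =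
        (-n - c) • (DualNumber.eps : DefBase) - TrivSqZeroExt.inl (-c) := by
      refine TrivSqZeroExt.ext ?_ ?_ <;> simp [deepWeight, h1, h3]
      ring
    rw [ih (-c) (-n - c) _ e1 e2 e3, pow_succ _ (j + 1)]
    congr 1
    ring

theorem pathValue_deep_singleton (w : DefRing) :
    pathValue (S := DefBase) defFunctional deepWeight [w] = (-constPart w) • DualNumber.eps := by
  rw [pathValue, defFunctional_deepWeight, pathValue]
  refine TrivSqZeroExt.ext ?_ ?_ <;> simp [defFunctional, deepWeight, constPart]

theorem pathValue_deep (w : DefRing) (j : ℕ) :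
    pathValue (S := DefBase) defFunctional deepWeight (List.replicate (j + 1) deepWeight ++ [w]) =
      ((-1) ^ (j + 1) * epsPart w) • DualNumber.eps := by
  have e : deepWeight * (algebraMap DefBase DefRing (defFunctional deepWeight) - deepWeight) =
      TrivSqZeroExt.inr (0, -1) := by
    rw [defFunctional_deepWeight]
    refine DefRing.ext' ?_ ?_ ?_ <;> simp [deepWeight]
  have e' : defFunctional (TrivSqZeroExt.inr (0, -1)) = - DualNumber.eps := by
    simp [defFunctional]
  rw [List.replicate_succ, List.cons_append, pathValue, e]
  cases j with
  | zero =>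
    rw [List.replicate_zero, List.nil_append, pathValue, e', pathValue]
    refine TrivSqZeroExt.ext ?_ ?_ <;>
      simp [defFunctional, epsPart, TrivSqZeroExt.algebraMap_eq_inl]
  | succ j =>
    rw [List.replicate_succ, List.cons_append, pathValue, e', pathValue_tail (-1) (-1)]
    · congr 1
      ring
    · refine TrivSqZeroExt.ext ?_ ?_ <;> simp [deepWeight, TrivSqZeroExt.algebraMap_eq_inl]
    · simp [deepWeight, TrivSqZeroExt.algebraMap_eq_inl]
    · refine TrivSqZeroExt.ext ?_ ?_ <;> simp [deepWeight, TrivSqZeroExt.algebraMap_eq_inl]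

theorem cycleValue_deep (w : DefRing) (k : ℕ) :
    cycleValue (S := DefBase) defFunctional w (List.replicate (k + 1) deepWeight) =
      ((-1) ^ (k + 1) * (constPart w - k * epsPart w)) • DualNumber.eps := by
  have hb : ∀ w, constPart (w * deepWeight) = constPart w := fun w => by
    rw [constPart_mul]
    simp [constPart, deepWeight]
  have ha : ∀ w, epsPart (w * deepWeight) = epsPart w := fun w => by
    rw [epsPart_mul]
    simp [constPart, epsPart, deepWeight]
  induction k generalizing w with
  | zero =>
    simp only [zero_add, List.replicate_one, cycleValue, List.nil_append, sub_zero,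
      pathValue_deep_singleton]
    congr 1
    simp
  | succ k ih =>
    rw [List.replicate_succ, cycleValue, pathValue_deep, ih, ← sub_smul, hb, ha]
    congr 1
    push_cast
    ring

end NilpotentModel

section ColorSums

open MvPowerSeries

/-- The coefficients of all monomials in the variables from `s` agree. -/
def AgreeOn (s : Finset ℕ) (f g : MvPowerSeries ℕ ℚ) : Prop :=
  ∀ d : ℕ →₀ ℕ, d.support ⊆ s → coeff d f = coeff d g

namespace AgreeOn

variable {s : Finset ℕ} {f g f' g' : MvPowerSeries ℕ ℚ}

theorem refl (f : MvPowerSeries ℕ ℚ) : AgreeOn s f f := fun _ _ => rfl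

theorem symm (h : AgreeOn s f g) : AgreeOn s g f := fun d hd => (h d hd).symm

theorem trans {h : MvPowerSeries ℕ ℚ} (h₁ : AgreeOn s f g) (h₂ : AgreeOn s g h) : AgreeOn s f h :=
  fun d hd => (h₁ d hd).trans (h₂ d hd)

theorem sub (h₁ : AgreeOn s f f') (h₂ : AgreeOn s g g') : AgreeOn s (f - g) (f' - g') :=
  fun d hd => by rw [map_sub, map_sub, h₁ d hd, h₂ d hd]

theorem mul (h₁ : AgreeOn s f f') (h₂ : AgreeOn s g g') : AgreeOn s (f * g) (f' * g') := by
  intro d hd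
  rw [coeff_mul, coeff_mul]
  refine Finset.sum_congr rfl fun p hp => ?_
  have hp' := Finset.HasAntidiagonal.mem_antidiagonal.1 hp
  have h1 : p.1 ≤ d := hp' ▸ le_self_add
  have h2 : p.2 ≤ d := hp' ▸ le_add_self
  rw [h₁ _ ((Finsupp.support_mono h1).trans hd), h₂ _ ((Finsupp.support_mono h2).trans hd)]

theorem pow (h : AgreeOn s f g) (k : ℕ) : AgreeOn s (f ^ k) (g ^ k) := by
  induction k with
  | zero => simpa using refl 1
  | succ k ih => simpa [pow_succ] using ih.mul h

theorem prod {ι : Type*} (t : Finset ι) {f g : ι → MvPowerSeries ℕ ℚ}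
    (h : ∀ i ∈ t, AgreeOn s (f i) (g i)) : AgreeOn s (∏ i ∈ t, f i) (∏ i ∈ t, g i) := by
  classical
  induction t using Finset.induction_on with
  | empty => simpa using refl 1
  | insert a t ha ih =>
    rw [Finset.prod_insert ha, Finset.prod_insert ha]
    exact (h a (Finset.mem_insert_self _ _)).mul
      (ih fun i hi => h i (Finset.mem_insert_of_mem hi))

theorem sum {ι : Type*} (t : Finset ι) {f g : ι → MvPowerSeries ℕ ℚ}
    (h : ∀ i ∈ t, AgreeOn s (f i) (g i)) : AgreeOn s (∑ i ∈ t, f i) (∑ i ∈ t, g i) := by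
  intro d hd
  rw [map_sum, map_sum]
  exact Finset.sum_congr rfl fun i hi => h i hi d hd

theorem eq_of_forall (h : ∀ s, AgreeOn s f g) : f = g :=
  MvPowerSeries.ext fun d => h d.support d subset_rfl

end AgreeOn

open Classical in
/-- The power sum `∑ᵢ xᵢᵏ`, for `k ≥ 1`. -/
noncomputable def powerSumSeries (k : ℕ) : MvPowerSeries ℕ ℚ :=
  fun d => if ∃ i, d = Finsupp.single i k then 1 else 0

open Classical in
theorem coeff_powerSumSeries {k : ℕ} (d : ℕ →₀ ℕ) :
    coeff d (powerSumSeries k) = if ∃ i, d = Finsupp.single i k then 1 else 0 := rfl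

theorem powerSumSeries_agreeOn (s : Finset ℕ) {k : ℕ} (hk : k ≠ 0) :
    AgreeOn s (powerSumSeries k) (∑ i ∈ s, X i ^ k) := by
  classical
  intro d hd
  rw [coeff_powerSumSeries, map_sum]
  simp only [coeff_X_pow]
  split_ifs with h
  · obtain ⟨i, rfl⟩ := h
    have hi : i ∈ s := hd (by simp [hk])
    rw [Finset.sum_eq_single i, if_pos rfl]
    · intro j _ hj
      rw [if_neg]
      intro h
      rw [Finsupp.single_eq_single_iff] at h
      rcases h with h | h
      · exact hj h.1.symm
      · exact hk h.1
    · exact fun h => absurd hi h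
  · exact (Finset.sum_eq_zero fun j _ => if_neg fun hj => h ⟨j, hj⟩).symm

variable {V : Type*} [Fintype V]

open Classical in
/-- The generating function of the colorings with colors in `s` that are constant on the classes
of `r` and proper along `es`. -/
noncomputable def colorSum (s : Finset ℕ) (es : List (V × V)) (r : Setoid V) :
    MvPowerSeries ℕ ℚ :=
  ∑ κ ∈ (Fintype.piFinset fun _ : V => s).filter
    (fun κ => r ≤ Setoid.ker κ ∧ ∀ e ∈ es, κ e.1 ≠ κ e.2), ∏ v, X (κ v)

theorem colorSum_eq_delContr (s : Finset ℕ) (es : List (V × V)) (r : Setoid V) :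
    colorSum s es r = delContr (colorSum s []) es r := by
  classical
  induction es generalizing r with
  | nil => rfl
  | cons e es ih =>
    rw [delContr, ← ih, ← ih, eq_sub_iff_add_eq]
    unfold colorSum
    rw [← Finset.sum_filter_add_sum_filter_not ((Fintype.piFinset fun _ : V => s).filter
      (fun κ => r ≤ Setoid.ker κ ∧ ∀ e ∈ es, κ e.1 ≠ κ e.2)) (fun κ : V → ℕ => κ e.1 ≠ κ e.2)]
    rw [Finset.filter_filter, Finset.filter_filter]
    congr 1
    · refine Finset.sum_congr (Finset.filter_congr fun κ _ => ?_) fun _ _ => rfl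
      rw [List.forall_mem_cons]
      tauto
    · refine Finset.sum_congr (Finset.filter_congr fun κ _ => ?_) fun _ _ => rfl
      rw [sup_pairSetoid_le_iff, Setoid.ker_def, not_not]
      tauto

theorem colorSum_nil (s : Finset ℕ) (r : Setoid V) :
    colorSum s [] r = ∏ K ∈ blocks r, ∑ i ∈ s, (X i : MvPowerSeries ℕ ℚ) ^ K.card := by
  classical
  rw [← Finset.prod_coe_sort, Finset.prod_univ_sum]
  unfold colorSum
  symm
  refine Finset.sum_nbij (fun g v => g ⟨block r v, mem_blocks.2 ⟨v, rfl⟩⟩) ?_ ?_ ?_ ?_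
  · intro g hg
    rw [Fintype.mem_piFinset] at hg
    refine Finset.mem_filter.2 ⟨Fintype.mem_piFinset.2 fun v => hg _, ?_, by simp⟩
    intro a b hab
    rw [Setoid.ker_def]
    congr 2
    exact block_eq_of_mem hab
  · intro g _ g' _ h
    funext ⟨K, hK⟩
    obtain ⟨v, rfl⟩ := mem_blocks.1 hK
    exact congrFun h v
  · intro κ hκ
    obtain ⟨h1, h2, -⟩ := Finset.mem_filter.1 hκ
    rw [Fintype.mem_piFinset] at h1
    have hne : ∀ K : {K // K ∈ blocks r}, K.1.Nonempty := by
      rintro ⟨K, hK⟩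
      obtain ⟨v, rfl⟩ := mem_blocks.1 hK
      exact block_nonempty r v
    refine ⟨fun K => κ (hne K).choose, ?_, ?_⟩
    · exact Finset.mem_coe.2 (Fintype.mem_piFinset.2 fun K => h1 _)
    · funext v
      have := (hne ⟨block r v, mem_blocks.2 ⟨v, rfl⟩⟩).choose_spec
      exact (h2 (mem_block.1 this)).symm
  · intro g _
    rw [← prod_blocks r, ← Finset.prod_coe_sort (blocks r)]
    refine Finset.prod_congr rfl fun K _ => ?_
    symm
    refine Finset.prod_eq_pow_card fun v hv => ?_
    obtain ⟨K, hK⟩ := K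
    obtain ⟨x, rfl⟩ := mem_blocks.1 hK
    exact congrArg (fun K => X (g K)) (Subtype.ext (block_eq_of_mem (mem_block.1 hv)).symm)

/-- The list `es` enumerates the edges of `G`, possibly with repetitions and in any orientation. -/
def EnumeratesEdges (G : SimpleGraph V) (es : List (V × V)) : Prop :=
  ∀ κ : V → ℕ, (∀ e ∈ es, κ e.1 ≠ κ e.2) ↔ ∀ a b, G.Adj a b → κ a ≠ κ b

theorem mem_support_of_sum_single {κ : V → ℕ} {d : ℕ →₀ ℕ}
    (hκ : ∑ v, Finsupp.single (κ v) 1 = d) (v : V) : κ v ∈ d.support := by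
  rw [Finsupp.mem_support_iff, ← DFunLike.congr_fun hκ, Finsupp.finsetSum_apply]
  intro h0
  have := (Finset.sum_eq_zero_iff_of_nonneg (fun _ _ => Nat.zero_le _)).1 h0 v
    (Finset.mem_univ v)
  simp at this

theorem chromaticSymm_agreeOn (s : Finset ℕ) {G : SimpleGraph V} {es : List (V × V)}
    (h : EnumeratesEdges G es) : AgreeOn s (chromaticSymm G) (colorSum s es ⊥) := by
  classical
  intro d hd
  have hX : ∀ κ : V → ℕ, (∏ v, X (κ v) : MvPowerSeries ℕ ℚ) =
      monomial (∑ v, Finsupp.single (κ v) 1) 1 := by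
    intro κ
    simp only [X_def]
    rw [prod_monomial, Finset.prod_const_one]
  unfold colorSum
  simp only [map_sum, hX, coeff_monomial]
  rw [Finset.sum_ite, Finset.sum_const_zero, add_zero, Finset.sum_const, nsmul_eq_mul, mul_one]
  change (Nat.card _ : ℚ) = _
  congr 1
  rw [Finset.filter_filter, ← Fintype.card_coe, ← Nat.card_eq_fintype_card]
  refine Nat.card_congr ⟨fun κ => ⟨κ.1, ?_⟩, fun κ => ⟨⟨κ.1, ?_⟩, ?_⟩, fun κ => rfl, fun κ => rfl⟩
  · refine Finset.mem_filter.2 ⟨Fintype.mem_piFinset.2 fun v => hd ?_, ⟨bot_le, ?_⟩, κ.2.symm⟩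
    · exact mem_support_of_sum_single κ.2 v
    · exact (h _).2 fun a b hab => κ.1.valid hab
  · intro a b hab
    exact (h _).1 (Finset.mem_filter.1 κ.2).2.1.2 a b hab
  · exact (Finset.mem_filter.1 κ.2).2.2.symm

/-- The expansion of `X_G` in power sums, in deletion–contraction form. -/
theorem chromaticSymm_eq_delContr {G : SimpleGraph V} {es : List (V × V)}
    (h : EnumeratesEdges G es) : chromaticSymm G =
      delContr (fun r => ∏ K ∈ blocks r, powerSumSeries K.card) es ⊥ := by
  refine AgreeOn.eq_of_forall fun s => (chromaticSymm_agreeOn s h).trans ?_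
  rw [colorSum_eq_delContr]
  refine delContr_rel (AgreeOn s) (fun _ _ _ _ => AgreeOn.sub) (fun r => ?_) es ⊥
  rw [colorSum_nil]
  refine AgreeOn.prod _ fun K hK => (powerSumSeries_agreeOn s ?_).symm
  obtain ⟨v, rfl⟩ := mem_blocks.1 hK
  exact Finset.card_ne_zero.2 (block_nonempty r v)

/-- The edges of the star with center `0`. -/
def starPairs (k : ℕ) : List (Fin (k + 1) × Fin (k + 1)) :=
  (List.finRange k).map fun j => (0, j.succ)

theorem enumeratesEdges_star (k : ℕ) :
    EnumeratesEdges (SimpleGraph.starGraph (0 : Fin (k + 1))) (starPairs k) := by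
  intro κ
  simp only [starPairs, List.mem_map, List.mem_finRange, true_and, forall_exists_index,
    forall_apply_eq_imp_iff, SimpleGraph.starGraph_adj]
  constructor
  · rintro h a b ⟨hab, rfl | rfl⟩
    · obtain ⟨j, rfl⟩ := Fin.exists_succ_eq.2 hab.symm
      exact h j
    · obtain ⟨j, rfl⟩ := Fin.exists_succ_eq.2 hab
      exact (h j).symm
  · exact fun h j => h 0 j.succ ⟨(Fin.succ_ne_zero j).symm, Or.inl rfl⟩

theorem colorSum_star (s : Finset ℕ) (k : ℕ) :
    colorSum s (starPairs k) ⊥ =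
      ∑ i ∈ s, X i * (∑ j ∈ s, (X j : MvPowerSeries ℕ ℚ) - X i) ^ k := by
  classical
  have h1 : ∀ i ∈ s, (∑ j ∈ s, (X j : MvPowerSeries ℕ ℚ) - X i) ^ k =
      ∑ x ∈ Fintype.piFinset fun _ : Fin k => s.erase i, ∏ v, X (x v) := by
    intro i hi
    rw [Finset.sum_prod_piFinset, Finset.prod_const, Finset.card_univ, Fintype.card_fin,
      ← Finset.sum_erase_eq_sub hi]
  rw [Finset.sum_congr rfl fun i hi => by rw [h1 i hi, Finset.mul_sum], Finset.sum_sigma']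
  unfold colorSum
  refine Finset.sum_nbij' (fun κ => ⟨κ 0, Fin.tail κ⟩) (fun p => Fin.cons p.1 p.2) ?_ ?_ ?_ ?_ ?_
  · intro κ hκ
    simp only [starPairs, Finset.mem_filter, Fintype.mem_piFinset, List.mem_map, List.mem_finRange,
      true_and, forall_exists_index, forall_apply_eq_imp_iff] at hκ
    simp only [Finset.mem_sigma, Fintype.mem_piFinset, Finset.mem_erase, Fin.tail]
    exact ⟨hκ.1 0, fun j => ⟨(hκ.2.2 j).symm, hκ.1 _⟩⟩
  · rintro ⟨i, x⟩ hx
    simp only [Finset.mem_sigma, Fintype.mem_piFinset, Finset.mem_erase] at hx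
    simp only [starPairs, Finset.mem_filter, Fintype.mem_piFinset, List.mem_map, List.mem_finRange,
      true_and, forall_exists_index, forall_apply_eq_imp_iff, Fin.forall_fin_succ, Fin.cons_zero,
      Fin.cons_succ]
    exact ⟨⟨hx.1, fun j => (hx.2 j).2⟩, bot_le, fun j => (hx.2 j).1.symm⟩
  · exact fun κ _ => Fin.cons_self_tail κ
  · rintro ⟨i, x⟩ _
    simp
  · intro κ _
    rw [Fin.prod_univ_succ]
    rfl

theorem starSymm_agreeOn (s : Finset ℕ) (k : ℕ) : AgreeOn s (starSymm (k + 1))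
    (∑ i ∈ s, X i * (∑ j ∈ s, (X j : MvPowerSeries ℕ ℚ) - X i) ^ k) := by
  rw [← colorSum_star]
  exact chromaticSymm_agreeOn s (enumeratesEdges_star k)

theorem powerSumSeries_eq (k : ℕ) : powerSumSeries (k + 1) =
    ∑ j ∈ Finset.range (k + 1), ((-1) ^ j * (k.choose j : ℚ)) •
      (starSymm (j + 1) * starSymm 1 ^ (k - j)) := by
  refine AgreeOn.eq_of_forall fun s => (powerSumSeries_agreeOn s k.succ_ne_zero).trans ?_
  have h1 : AgreeOn s (starSymm 1) (∑ i ∈ s, X i) := by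
    simpa using starSymm_agreeOn s 0
  set P : MvPowerSeries ℕ ℚ := ∑ i ∈ s, X i with hP
  have h2 : ∑ i ∈ s, (X i : MvPowerSeries ℕ ℚ) ^ (k + 1) = ∑ j ∈ Finset.range (k + 1),
      C ((-1) ^ j * (k.choose j : ℚ)) * ((∑ i ∈ s, X i * (P - X i) ^ j) * P ^ (k - j)) := by
    have h3 : ∀ i : ℕ, (X i : MvPowerSeries ℕ ℚ) ^ (k + 1) = ∑ j ∈ Finset.range (k + 1),
        C ((-1) ^ j * (k.choose j : ℚ)) * (X i * (P - X i) ^ j * P ^ (k - j)) := by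
      intro i
      have : (X i : MvPowerSeries ℕ ℚ) ^ k = (-(P - X i) + P) ^ k := by
        congr 1
        ring
      rw [pow_succ', this, add_pow, Finset.mul_sum]
      refine Finset.sum_congr rfl fun j _ => ?_
      rw [neg_pow (P - X i) j, map_mul, map_pow, map_neg, map_one, map_natCast]
      ring
    rw [Finset.sum_congr rfl fun i _ => h3 i, Finset.sum_comm]
    refine Finset.sum_congr rfl fun j _ => ?_
    rw [Finset.sum_mul, Finset.mul_sum]
  rw [h2]
  refine AgreeOn.sum _ fun j _ => ?_
  rw [smul_eq_C_mul]
  exact (AgreeOn.refl _).mul ((starSymm_agreeOn s j).symm.mul (h1.symm.pow _))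

end ColorSums

section PowerSumIndependence

open MvPowerSeries

theorem coeff_prod_powerSumSeries (m : Multiset ℕ) (d : ℕ →₀ ℕ) :
    0 ≤ coeff d (m.map powerSumSeries).prod ∧ (coeff d (m.map powerSumSeries).prod ≠ 0 ↔
      ∃ q : Multiset (ℕ × ℕ), q.map Prod.fst = m ∧
        (q.map fun x => Finsupp.single x.2 x.1).sum = d) := by
  classical
  induction m using Multiset.induction_on generalizing d with
  | empty =>
    simp only [Multiset.map_zero, Multiset.prod_zero, coeff_one, Multiset.map_eq_zero]
    split_ifs with h
    · simp [h]
    · simp [Ne.symm h]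
  | cons k m ih =>
    rw [Multiset.map_cons, Multiset.prod_cons, coeff_mul]
    have hnn : ∀ p ∈ Finset.HasAntidiagonal.antidiagonal d, 0 ≤ coeff p.1 (powerSumSeries k) *
        coeff p.2 (m.map powerSumSeries).prod := by
      intro p _
      refine mul_nonneg ?_ (ih _).1
      rw [coeff_powerSumSeries]
      split_ifs <;> norm_num
    refine ⟨Finset.sum_nonneg hnn, ?_⟩
    rw [Ne, Finset.sum_eq_zero_iff_of_nonneg hnn]
    push Not
    constructor
    · rintro ⟨⟨d₁, d₂⟩, hp, hne⟩
      obtain ⟨h1, h2⟩ := mul_ne_zero_iff.1 hne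
      obtain ⟨q, hq, hqs⟩ := (ih _).2.1 h2
      rw [coeff_powerSumSeries] at h1
      obtain ⟨i, hi⟩ : ∃ i, d₁ = Finsupp.single i k := by
        by_contra h
        exact h1 (if_neg h)
      refine ⟨(k, i) ::ₘ q, by simp [hq], ?_⟩
      rw [Multiset.map_cons, Multiset.sum_cons, hqs, ← hi]
      exact Finset.HasAntidiagonal.mem_antidiagonal.1 hp
    · rintro ⟨q, hq, hqs⟩
      obtain ⟨⟨k', i⟩, hx, hk, hq'⟩ := (Multiset.map_eq_cons _ _ _ _).2 hq
      obtain rfl : k' = k := hk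
      obtain ⟨q', rfl⟩ := Multiset.exists_cons_of_mem hx
      rw [Multiset.erase_cons_head] at hq'
      refine ⟨(Finsupp.single i k', (q'.map fun x => Finsupp.single x.2 x.1).sum), ?_, ?_⟩
      · rw [Finset.HasAntidiagonal.mem_antidiagonal, ← hqs, Multiset.map_cons, Multiset.sum_cons]
      · refine mul_ne_zero ?_ ((ih _).2.2 ⟨q', hq', rfl⟩)
        rw [coeff_powerSumSeries, if_pos ⟨i, rfl⟩]
        exact one_ne_zero

theorem support_sum_single_subset (q : Multiset (ℕ × ℕ)) :
    (q.map fun x => Finsupp.single x.2 x.1).sum.support ⊆ (q.map Prod.snd).toFinset := by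
  classical
  induction q using Multiset.induction_on with
  | empty => simp
  | cons x q ih =>
    rw [Multiset.map_cons, Multiset.sum_cons, Multiset.map_cons, Multiset.toFinset_cons]
    refine Finsupp.support_add.trans (Finset.union_subset ?_ (ih.trans (Finset.subset_insert _ _)))
    exact Finsupp.support_single_subset.trans (by simp)

theorem map_support_sum_single {q : Multiset (ℕ × ℕ)} (hq : (q.map Prod.snd).Nodup)
    (hpos : ∀ x ∈ q, x.1 ≠ 0) :
    (q.map fun x => Finsupp.single x.2 x.1).sum.support.val.map
      (q.map fun x => Finsupp.single x.2 x.1).sum = q.map Prod.fst := by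
  classical
  induction q using Multiset.induction_on with
  | empty => simp
  | cons x q ih =>
    rw [Multiset.map_cons, Multiset.nodup_cons] at hq
    have ih' := ih hq.2 fun y hy => hpos y (Multiset.mem_cons_of_mem hy)
    rw [Multiset.map_cons, Multiset.sum_cons, Multiset.map_cons, ← ih']
    set d := (q.map fun x => Finsupp.single x.2 x.1).sum
    have hx : x.2 ∉ d.support := fun h =>
      hq.1 (by simpa using support_sum_single_subset q h)
    have hx1 : x.1 ≠ 0 := hpos x (Multiset.mem_cons_self _ _)
    have hs : (Finsupp.single x.2 x.1 + d).support = Finset.cons x.2 d.support hx := by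
      rw [Finsupp.support_add_eq, Finsupp.support_single _ hx1, Finset.cons_eq_insert]
      · rfl
      · rw [Finsupp.support_single _ hx1, Finset.disjoint_singleton_left]
        exact hx
    rw [hs, Finset.cons_val, Multiset.map_cons, Finsupp.add_apply, Finsupp.single_eq_same,
      Finsupp.notMem_support_iff.1 hx, add_zero]
    congr 1
    refine Multiset.map_congr rfl fun y hy => ?_
    have hne : x.2 ≠ y := fun h => hx (h ▸ hy)
    rw [Finsupp.add_apply, Finsupp.single_eq_of_ne' hne, zero_add]

/-- A monomial detecting the partition `m` among the power sum products with at most as many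
factors. -/
theorem exists_detecting_monomial {m : Multiset ℕ} (hm : ∀ i ∈ m, i ≠ 0) :
    ∃ d : ℕ →₀ ℕ, coeff d (m.map powerSumSeries).prod ≠ 0 ∧
      ∀ m' : Multiset ℕ, (∀ i ∈ m', i ≠ 0) → m'.card ≤ m.card →
        coeff d (m'.map powerSumSeries).prod ≠ 0 → m' = m := by
  classical
  have hpos : ∀ {q : Multiset (ℕ × ℕ)} {m : Multiset ℕ}, (∀ i ∈ m, i ≠ 0) → q.map Prod.fst = m →
      ∀ x ∈ q, x.1 ≠ 0 := fun hm hq x hx => hm _ (hq ▸ Multiset.mem_map_of_mem _ hx)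
  obtain ⟨q, hq1, hq2⟩ : ∃ q : Multiset (ℕ × ℕ), q.map Prod.fst = m ∧ (q.map Prod.snd).Nodup := by
    refine ⟨(m.toList.zipIdx : Multiset (ℕ × ℕ)), ?_, ?_⟩
    · rw [Multiset.map_coe, List.zipIdx_map_fst, Multiset.coe_toList]
    · rw [Multiset.map_coe, List.zipIdx_map_snd, Multiset.coe_nodup]
      exact List.nodup_range'
  have hval := map_support_sum_single hq2 (hpos hm hq1)
  rw [hq1] at hval
  refine ⟨(q.map fun x => Finsupp.single x.2 x.1).sum,
    (coeff_prod_powerSumSeries _ _).2.2 ⟨q, hq1, rfl⟩, fun m' hm' hcard hne => ?_⟩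
  obtain ⟨q', hq1', hsum⟩ := (coeff_prod_powerSumSeries _ _).2.1 hne
  have h1 := Finset.card_le_card (support_sum_single_subset q')
  rw [hsum] at h1
  have h2 : (q.map fun x => Finsupp.single x.2 x.1).sum.support.card = m.card := by
    rw [← hval, Multiset.card_map]
    rfl
  have h3 : (q'.map Prod.snd).card = m'.card := by
    rw [← hq1', Multiset.card_map, Multiset.card_map]
  have h4 : (q'.map Prod.snd).toFinset.card = (q'.map Prod.snd).card :=
    le_antisymm (Multiset.toFinset_card_le _) (by omega)
  have hval' := map_support_sum_single (Multiset.toFinset_card_eq_card_iff_nodup.1 h4)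
    (hpos hm' hq1')
  rw [hsum, hval, hq1'] at hval'
  exact hval'.symm

theorem linearIndependent_powerSum (n : ℕ) :
    LinearIndependent ℚ fun lam : n.Partition => (lam.parts.map powerSumSeries).prod := by
  classical
  rw [Fintype.linearIndependent_iff]
  intro g hg
  by_contra! hne
  obtain ⟨i₀, hi₀⟩ := hne
  obtain ⟨lam, hlam, hmax⟩ := Finset.exists_max_image (Finset.univ.filter fun i => g i ≠ 0)
    (fun i => i.parts.card) ⟨i₀, by simpa using hi₀⟩
  obtain ⟨d, hd, huniq⟩ := exists_detecting_monomial fun i hi => (lam.parts_pos hi).ne'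
  have h := congrArg (coeff d) hg
  rw [map_sum, map_zero, Finset.sum_eq_single lam] at h
  · rw [coeff_smul] at h
    exact (mul_ne_zero (Finset.mem_filter.1 hlam).2 hd) h
  · intro mu _ hmu
    rw [coeff_smul]
    by_cases hgm : g mu = 0
    · rw [hgm, zero_mul]
    · have hle := hmax mu (by simpa using hgm)
      by_cases hc : coeff d (mu.parts.map powerSumSeries).prod = 0
      · rw [hc, mul_zero]
      · exact absurd (Nat.Partition.ext
          (huniq _ (fun i hi => (mu.parts_pos hi).ne') hle hc)) hmu
  · exact fun h => absurd (Finset.mem_univ _) h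

end PowerSumIndependence

section PartitionWeight

/-- The weight `B ^ j` of `j`, with `0` having weight zero. -/
def digitWeight (B j : ℕ) : ℕ := if j = 0 then 0 else B ^ j

theorem digitWeight_mono {B : ℕ} (hB : 1 ≤ B) {i j : ℕ} (h : i ≤ j) :
    digitWeight B i ≤ digitWeight B j := by
  unfold digitWeight
  split_ifs with h1 h2
  · exact le_rfl
  · exact Nat.zero_le _
  · omega
  · exact Nat.pow_le_pow_right hB h

/-- The weight of a multiset of parts; parts equal to one have weight zero. -/
def partsWeight (B : ℕ) (m : Multiset ℕ) : ℕ := (m.map fun i => digitWeight B (i - 1)).sum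

theorem partsWeight_add (B : ℕ) (m m' : Multiset ℕ) :
    partsWeight B (m + m') = partsWeight B m + partsWeight B m' := by
  simp [partsWeight]

theorem partsWeight_lt_of_lt {B : ℕ} {l₁ l₂ : List ℕ} (h₁ : l₁.Pairwise (· ≥ ·))
    (hlen : l₁.length < B) (hsum : l₁.sum = l₂.sum) (hpos : ∀ i ∈ l₂, 0 < i) (h : l₁ < l₂) :
    partsWeight B l₁ < partsWeight B l₂ := by
  induction l₁ generalizing l₂ with
  | nil =>
    cases l₂ with
    | nil => exact absurd h (lt_irrefl _)
    | cons b l₂ =>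
      have := hpos b List.mem_cons_self
      simp at hsum
      omega
  | cons a l₁ ih =>
    cases l₂ with
    | nil => exact absurd h (List.not_lt_nil _)
    | cons b l₂ =>
      rw [List.cons_lt_cons_iff] at h
      rw [← Multiset.cons_coe, ← Multiset.cons_coe]
      rcases h with h | ⟨rfl, h⟩
      · have hle : partsWeight B (a ::ₘ (l₁ : Multiset ℕ)) ≤
            (l₁.length + 1) * digitWeight B (a - 1) := by
          have := Multiset.sum_le_card_nsmul
            ((a ::ₘ (l₁ : Multiset ℕ)).map fun i => digitWeight B (i - 1)) (digitWeight B (a - 1)) ?_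
          · rw [Multiset.card_map, Multiset.card_cons, Multiset.coe_card, smul_eq_mul] at this
            exact this
          · intro x hx
            obtain ⟨i, hi, rfl⟩ := Multiset.mem_map.1 hx
            refine digitWeight_mono (by omega) (Nat.sub_le_sub_right ?_ 1)
            rw [Multiset.mem_cons, Multiset.mem_coe] at hi
            rcases hi with rfl | hi
            · exact le_rfl
            · exact (List.pairwise_cons.1 h₁).1 i hi
        have hge : digitWeight B (b - 1) ≤ partsWeight B (b ::ₘ (l₂ : Multiset ℕ)) := by
          simp [partsWeight]
        refine lt_of_le_of_lt hle (lt_of_lt_of_le ?_ hge)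
        simp only [List.length_cons] at hlen
        by_cases ha : a - 1 = 0
        · have hb : b - 1 ≠ 0 := by
            rintro hb
            have hb1 : b = 1 := by omega
            have ha0 : a = 0 := by omega
            subst hb1 ha0
            have : ∀ i ∈ l₁, i = 0 := fun i hi => by
              have := (List.pairwise_cons.1 h₁).1 i hi
              omega
            have h0 : l₁.sum = 0 := List.sum_eq_zero this
            simp [h0] at hsum
            omega
          rw [digitWeight, if_pos ha, digitWeight, if_neg hb, mul_zero]
          exact Nat.pow_pos (by omega)
        · have hb : b - 1 ≠ 0 := by omega
          rw [digitWeight, if_neg ha, digitWeight, if_neg hb]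
          calc (l₁.length + 1) * B ^ (a - 1) < B * B ^ (a - 1) :=
                Nat.mul_lt_mul_of_pos_right hlen (Nat.pow_pos (by omega))
            _ = B ^ (a - 1 + 1) := (pow_succ' _ _).symm
            _ ≤ B ^ (b - 1) := Nat.pow_le_pow_right (by omega) (by omega)
      · have := ih (List.pairwise_cons.1 h₁).2 (by simp at hlen; omega) (by simpa using hsum)
          (fun i hi => hpos i (List.mem_cons_of_mem _ hi)) h
        rw [← Multiset.singleton_add, ← Multiset.singleton_add, partsWeight_add, partsWeight_add]
        omega

variable {n B : ℕ}

theorem card_parts_le (lam : n.Partition) : lam.parts.card ≤ n := by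
  have := Multiset.card_nsmul_le_sum (s := lam.parts) (a := 1) fun i hi => lam.parts_pos hi
  simpa [lam.parts_sum] using this

theorem partsWeight_lt_of_lex (hB : n < B) {mu lam : n.Partition} (h : PartitionLexLT mu lam) :
    partsWeight B mu.parts < partsWeight B lam.parts := by
  have key := partsWeight_lt_of_lt (B := B) (l₁ := mu.parts.sort (· ≥ ·))
    (l₂ := lam.parts.sort (· ≥ ·)) (Multiset.pairwise_sort _ _) ?_ ?_ ?_ h
  · rwa [Multiset.sort_eq, Multiset.sort_eq] at key
  · rw [Multiset.length_sort]
    exact (card_parts_le mu).trans_lt hB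
  · rw [← Multiset.sum_coe, ← Multiset.sum_coe, Multiset.sort_eq, Multiset.sort_eq, mu.parts_sum,
      lam.parts_sum]
  · exact fun i hi => lam.parts_pos (by simpa using hi)

theorem partitionLex_trichotomy (mu lam : n.Partition) :
    PartitionLexLT mu lam ∨ mu = lam ∨ PartitionLexLT lam mu := by
  rcases lt_trichotomy (mu.parts.sort (· ≥ ·)) (lam.parts.sort (· ≥ ·)) with h | h | h
  · exact Or.inl h
  · refine Or.inr (Or.inl (Nat.Partition.ext ?_))
    rw [← Multiset.sort_eq mu.parts (· ≥ ·), h, Multiset.sort_eq]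
  · exact Or.inr (Or.inr h)

theorem partsWeight_injective (hB : n < B) :
    Function.Injective fun lam : n.Partition => partsWeight B lam.parts := by
  intro mu lam h
  rcases partitionLex_trichotomy mu lam with h' | h' | h'
  · exact absurd h (partsWeight_lt_of_lex hB h').ne
  · exact h'
  · exact absurd h (partsWeight_lt_of_lex hB h').ne'

theorem partitionLex_of_partsWeight_le (hB : n < B) {mu lam : n.Partition}
    (h : partsWeight B mu.parts ≤ partsWeight B lam.parts) : lam = mu ∨ PartitionLexLT mu lam := by
  rcases partitionLex_trichotomy mu lam with h' | h' | h'
  · exact Or.inr h'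
  · exact Or.inl h'.symm
  · exact absurd (partsWeight_lt_of_lex hB h') h.not_gt

theorem isLeadingPartition_unique {c : n.Partition → ℚ} {lam lam' : n.Partition}
    (h : IsLeadingPartition c lam) (h' : IsLeadingPartition c lam') : lam' = lam := by
  rcases h.2 lam' h'.1 with e | e
  · exact e
  · rcases h'.2 lam h.1 with e' | e'
    · exact e'.symm
    · exact absurd (lt_trans (a := lam.parts.sort (· ≥ ·)) e e') (lt_irrefl _)

theorem exists_isLeadingPartition {c : n.Partition → ℚ} (hc : c ≠ 0) :
    ∃ lam, IsLeadingPartition c lam := by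
  classical
  obtain ⟨i₀, hi₀⟩ := Function.ne_iff.1 hc
  obtain ⟨lam, hlam, hmin⟩ := Finset.exists_min_image (Finset.univ.filter fun i => c i ≠ 0)
    (fun i => partsWeight (n + 1) i.parts) ⟨i₀, by simpa using hi₀⟩
  exact ⟨lam, (Finset.mem_filter.1 hlam).2, fun mu hmu =>
    partitionLex_of_partsWeight_le (Nat.lt_succ_self n) (hmin mu (by simpa using hmu))⟩

end PartitionWeight

section StarSpan

open Polynomial

/-- The span of the star basis elements of degree `n`, each paired with a power of a variable. -/
noncomputable def starSpan (B n : ℕ) : Submodule ℚ (MvPowerSeries ℕ ℚ × ℚ[X]) :=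
  Submodule.span ℚ (Set.range fun lam : n.Partition =>
    (starBasisElt lam, (X ^ partsWeight B lam.parts : ℚ[X])))

theorem one_mem_starSpan (B : ℕ) : (1 : MvPowerSeries ℕ ℚ × ℚ[X]) ∈ starSpan B 0 := by
  refine Submodule.subset_span ⟨⟨0, by simp, by simp⟩, ?_⟩
  simp [starBasisElt, partsWeight]

theorem mul_mem_starSpan {B m n : ℕ} {x y : MvPowerSeries ℕ ℚ × ℚ[X]} (hx : x ∈ starSpan B m)
    (hy : y ∈ starSpan B n) : x * y ∈ starSpan B (m + n) := by
  have h := Submodule.mul_mem_mul hx hy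
  rw [starSpan, starSpan, Submodule.span_mul_span] at h
  refine Submodule.span_mono ?_ h
  rintro _ ⟨_, ⟨lam, rfl⟩, _, ⟨mu, rfl⟩, rfl⟩
  refine ⟨⟨lam.parts + mu.parts, ?_, ?_⟩, ?_⟩
  · intro i hi
    rcases Multiset.mem_add.1 hi with hi | hi
    · exact lam.parts_pos hi
    · exact mu.parts_pos hi
  · rw [Multiset.sum_add, lam.parts_sum, mu.parts_sum]
  · simp [starBasisElt, partsWeight_add, pow_add]

theorem pow_mem_starSpan {B n : ℕ} {x : MvPowerSeries ℕ ℚ × ℚ[X]} (hx : x ∈ starSpan B n) (k : ℕ) :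
    x ^ k ∈ starSpan B (k * n) := by
  induction k with
  | zero => simpa using one_mem_starSpan B
  | succ k ih =>
    rw [pow_succ, Nat.succ_mul]
    exact mul_mem_starSpan ih hx

theorem prod_mem_starSpan {B : ℕ} {ι : Type*} (t : Finset ι) (f : ι → ℕ)
    (x : ι → MvPowerSeries ℕ ℚ × ℚ[X]) (h : ∀ i ∈ t, x i ∈ starSpan B (f i)) :
    ∏ i ∈ t, x i ∈ starSpan B (∑ i ∈ t, f i) := by
  classical
  induction t using Finset.induction_on with
  | empty => simpa using one_mem_starSpan B
  | insert a t ha ih =>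
    rw [Finset.prod_insert ha, Finset.sum_insert ha]
    exact mul_mem_starSpan (h a (Finset.mem_insert_self _ _))
      (ih fun i hi => h i (Finset.mem_insert_of_mem hi))

theorem starSymm_mem_starSpan (B j : ℕ) :
    (starSymm (j + 1), (X ^ digitWeight B j : ℚ[X])) ∈ starSpan B (j + 1) :=
  Submodule.subset_span ⟨⟨{j + 1}, by simp, by simp⟩, by simp [starBasisElt, partsWeight]⟩

/-- The image of the power sum of degree `k ≥ 1` when `st_{j+1}` is replaced by a power. -/
noncomputable def powerSumImage (B k : ℕ) : ℚ[X] :=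
  ∑ j ∈ Finset.range k, ((-1) ^ j * ((k - 1).choose j : ℚ)) • X ^ digitWeight B j

theorem powerSum_mem_starSpan (B : ℕ) {k : ℕ} (hk : k ≠ 0) :
    (powerSumSeries k, powerSumImage B k) ∈ starSpan B k := by
  obtain ⟨k, rfl⟩ := Nat.exists_eq_succ_of_ne_zero hk
  have : (powerSumSeries (k + 1), powerSumImage B (k + 1)) = ∑ j ∈ Finset.range (k + 1),
      ((-1) ^ j * (k.choose j : ℚ)) • ((starSymm (j + 1), (X ^ digitWeight B j : ℚ[X])) *
        (starSymm 1, (X ^ digitWeight B 0 : ℚ[X])) ^ (k - j)) := by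
    refine Prod.ext ?_ ?_
    · simp [Prod.fst_sum, powerSumSeries_eq]
    · simp [Prod.snd_sum, powerSumImage, digitWeight]
  rw [Nat.succ_eq_add_one, this]
  refine Submodule.sum_mem _ fun j hj => Submodule.smul_mem _ _ ?_
  have hj' := Finset.mem_range.1 hj
  have h := mul_mem_starSpan (starSymm_mem_starSpan B j)
    (pow_mem_starSpan (starSymm_mem_starSpan B 0) (k - j))
  convert h using 2
  omega

theorem linearIndependent_starBasisElt (n : ℕ) :
    LinearIndependent ℚ (starBasisElt : n.Partition → MvPowerSeries ℕ ℚ) := by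
  have hle : Set.finrank ℚ (Set.range fun lam : n.Partition =>
      (lam.parts.map powerSumSeries).prod) ≤
      Set.finrank ℚ (Set.range (starBasisElt : n.Partition → MvPowerSeries ℕ ℚ)) := by
    have : FiniteDimensional ℚ (Submodule.span ℚ
        (Set.range (starBasisElt : n.Partition → MvPowerSeries ℕ ℚ))) :=
      FiniteDimensional.span_of_finite ℚ (Set.finite_range _)
    refine Submodule.finrank_mono (Submodule.span_le.2 ?_)
    rintro _ ⟨lam, rfl⟩
    have key : ∀ m : Multiset ℕ, (∀ i ∈ m, 0 < i) →
        ((m.map powerSumSeries).prod, (m.map (powerSumImage 0)).prod) ∈ starSpan 0 m.sum := by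
      intro m hm
      induction m using Multiset.induction_on with
      | empty => exact one_mem_starSpan 0
      | cons k m ih =>
        rw [Multiset.map_cons, Multiset.map_cons, Multiset.prod_cons, Multiset.prod_cons,
          Multiset.sum_cons]
        exact mul_mem_starSpan (powerSum_mem_starSpan 0 (hm k (Multiset.mem_cons_self _ _)).ne')
          (ih fun i hi => hm i (Multiset.mem_cons_of_mem hi))
    have h := Submodule.mem_map_of_mem (f := LinearMap.fst ℚ (MvPowerSeries ℕ ℚ) ℚ[X])
      (key lam.parts fun i hi => lam.parts_pos hi)
    rw [lam.parts_sum, starSpan, Submodule.map_span, ← Set.range_comp] at h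
    exact h
  rw [linearIndependent_iff_card_le_finrank_span]
  rwa [← linearIndependent_iff_card_eq_finrank_span.1 (linearIndependent_powerSum n)] at hle

variable {V : Type*} [Fintype V]

/-- The star expansion exists, and determines the image of `X_G` when `st_{j+1}` is replaced by a
power of a variable. -/
theorem exists_starExpansion (B : ℕ) {G : SimpleGraph V} {es : List (V × V)}
    (h : EnumeratesEdges G es) : ∃ c : (Fintype.card V).Partition → ℚ, IsStarExpansion G c ∧
      delContr (fun r => ∏ K ∈ blocks r, powerSumImage B K.card) es ⊥ =
        ∑ lam, c lam • (X ^ partsWeight B lam.parts : ℚ[X]) := by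
  have key : (chromaticSymm G, delContr (fun r => ∏ K ∈ blocks r, powerSumImage B K.card) es ⊥) ∈
      starSpan B (Fintype.card V) := by
    rw [chromaticSymm_eq_delContr h]
    refine delContr_rel (fun x y => (x, y) ∈ starSpan B (Fintype.card V))
      (fun a b c d h₁ h₂ => Submodule.sub_mem _ h₁ h₂) (fun r => ?_) es ⊥
    have h1 := prod_mem_starSpan (B := B) (blocks r) Finset.card
      (fun K => (powerSumSeries K.card, powerSumImage B K.card)) fun K hK => by
        obtain ⟨v, rfl⟩ := mem_blocks.1 hK
        exact powerSum_mem_starSpan B (Finset.card_ne_zero.2 (block_nonempty r v))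
    have h2 : ∑ K ∈ blocks r, K.card = Fintype.card V := by
      have := sum_blocks r fun _ => 1
      simpa using this
    rw [h2] at h1
    convert h1 using 1
    refine Prod.ext ?_ ?_
    · simp [Prod.fst_prod]
    · simp [Prod.snd_prod]
  obtain ⟨c, hc⟩ := (Submodule.mem_span_range_iff_exists_fun ℚ).1 key
  refine ⟨c, ?_, ?_⟩
  · have := congrArg Prod.fst hc
    rw [Prod.fst_sum] at this
    exact this.symm
  · have := congrArg Prod.snd hc
    rw [Prod.snd_sum] at this
    exact this.symm

theorem isStarExpansion_unique {G : SimpleGraph V} {c c' : (Fintype.card V).Partition → ℚ}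
    (h : IsStarExpansion G c) (h' : IsStarExpansion G c') : c' = c := by
  have := linearIndependent_starBasisElt (Fintype.card V)
  rw [Fintype.linearIndependent_iff] at this
  funext lam
  have h0 := this (fun lam => c' lam - c lam) (by
    simp only [sub_smul, Finset.sum_sub_distrib]
    rw [← h, ← h', sub_self]) lam
  exact sub_eq_zero.1 h0

theorem chromaticSymm_ne_zero (G : SimpleGraph V) : chromaticSymm G ≠ 0 := by
  classical
  intro h
  obtain ⟨f⟩ : Nonempty (V ↪ ℕ) := ⟨(Fintype.equivFin V).toEmbedding.trans Fin.valEmbedding⟩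
  have h0 := congrFun h (∑ v, Finsupp.single (f v) 1)
  have h1 : Nat.card {κ : G.Coloring ℕ // ∑ v, Finsupp.single (κ v) 1 =
      ∑ v, Finsupp.single (f v) 1} = 0 := by
    have : ((Nat.card {κ : G.Coloring ℕ // ∑ v, Finsupp.single (κ v) 1 =
      ∑ v, Finsupp.single (f v) 1} : ℕ) : ℚ) = 0 := h0
    exact_mod_cast this
  have hfin : Finite {κ : G.Coloring ℕ // ∑ v, Finsupp.single (κ v) 1 =
      ∑ v, Finsupp.single (f v) 1} := by
    refine Finite.of_injective (β := V → (∑ v, Finsupp.single (f v) 1 : ℕ →₀ ℕ).support)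
      (fun κ v => ⟨κ.1 v, mem_support_of_sum_single κ.2 v⟩) fun κ κ' h => ?_
    exact Subtype.ext (DFunLike.ext _ _ fun v => congrArg Subtype.val (congrFun h v))
  have hne : Nonempty {κ : G.Coloring ℕ // ∑ v, Finsupp.single (κ v) 1 =
      ∑ v, Finsupp.single (f v) 1} :=
    ⟨⟨SimpleGraph.Coloring.mk f fun hab h => hab.ne (f.injective h), rfl⟩⟩
  exact absurd h1 Nat.card_pos.ne'

end StarSpan

section StarFunctional

open Polynomial

/-- The functional `x ^ j ↦ T ^ (digitWeight B j)`. -/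
noncomputable def digitFunctional (B : ℕ) : ℚ[X][X] →ₗ[ℚ[X]] ℚ[X] :=
  Polynomial.lsum fun j => LinearMap.toSpanSingleton ℚ[X] ℚ[X] (X ^ digitWeight B j)

theorem digitFunctional_monomial (B j : ℕ) (a : ℚ[X]) :
    digitFunctional B (monomial j a) = a * X ^ digitWeight B j := by
  simp [digitFunctional, Polynomial.lsum_apply]

theorem digitFunctional_one_sub_pow_mul (B k M : ℕ) :
    digitFunctional B ((1 - X) ^ k * X ^ M) = ∑ j ∈ Finset.range (k + 1),
      ((-1) ^ j * (k.choose j : ℚ)) • (X ^ digitWeight B (M + j) : ℚ[X]) := by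
  have h : ((1 - X) ^ k * X ^ M : ℚ[X][X]) = ∑ j ∈ Finset.range (k + 1),
      monomial (M + j) (C ((-1) ^ j * (k.choose j : ℚ))) := by
    rw [sub_eq_neg_add, add_pow, Finset.sum_mul]
    refine Finset.sum_congr rfl fun j _ => ?_
    rw [← C_mul_X_pow_eq_monomial, neg_pow, one_pow, mul_one, pow_add]
    simp only [map_mul, map_pow, map_neg, map_one, map_natCast]
    ring
  rw [h, map_sum]
  refine Finset.sum_congr rfl fun j _ => ?_
  rw [digitFunctional_monomial, smul_eq_C_mul]

/-- The functional `x (1 - x) ^ j ↦ T ^ (digitWeight B j)`. -/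
noncomputable def starFunctional (B : ℕ) : ℚ[X][X] →ₗ[ℚ[X]] ℚ[X] where
  toFun q := digitFunctional B (aeval (1 - X) (divX q))
  map_add' p q := by rw [divX_add, map_add, map_add]
  map_smul' c q := by
    rw [smul_eq_C_mul, divX_C_mul, ← smul_eq_C_mul, map_smul, map_smul, RingHom.id_apply]

theorem starFunctional_X_mul (B : ℕ) (q : ℚ[X][X]) :
    starFunctional B (X * q) = digitFunctional B (aeval (1 - X) q) := by
  change digitFunctional B (aeval (1 - X) (divX (X * q))) = _
  congr 2
  ext n
  rw [coeff_divX, coeff_X_mul]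

theorem starFunctional_pow_mul (B : ℕ) {k : ℕ} (hk : k ≠ 0) (M : ℕ) :
    starFunctional B (X ^ k * (1 - X) ^ M) = ∑ j ∈ Finset.range k,
      ((-1) ^ j * ((k - 1).choose j : ℚ)) • (X ^ digitWeight B (M + j) : ℚ[X]) := by
  obtain ⟨k, rfl⟩ := Nat.exists_eq_succ_of_ne_zero hk
  rw [pow_succ', mul_assoc, starFunctional_X_mul, map_mul, map_pow, map_pow, aeval_X, map_sub,
    map_one, aeval_X, sub_sub_cancel, digitFunctional_one_sub_pow_mul]
  rfl

theorem starFunctional_X_pow (B : ℕ) {k : ℕ} (hk : k ≠ 0) :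
    starFunctional B (X ^ k) = powerSumImage B k := by
  have := starFunctional_pow_mul B hk 0
  simpa [powerSumImage] using this

theorem starFunctional_X (B : ℕ) : starFunctional B X = 1 := by
  have := starFunctional_X_pow B one_ne_zero
  simpa [powerSumImage, digitWeight] using this

theorem blockWeight_X {V : Type*} [Fintype V] (B : ℕ) (r : Setoid V) :
    blockWeight (starFunctional B) (fun _ : V => X) r = ∏ K ∈ blocks r, powerSumImage B K.card := by
  refine Finset.prod_congr rfl fun K hK => ?_
  obtain ⟨v, rfl⟩ := mem_blocks.1 hK
  rw [Finset.prod_const, starFunctional_X_pow _ (Finset.card_ne_zero.2 (block_nonempty r v))]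

/-- `g = c₀ - c₁ T ^ B` up to higher order terms, where `s = c₀ + c₁ t`. -/
def Approx (B : ℕ) (g : ℚ[X]) (s : DefBase) : Prop :=
  X ^ (B + 1) ∣ g - (C s.fst - C s.snd * X ^ B)

namespace Approx

variable {B : ℕ} {g g' : ℚ[X]} {s s' : DefBase}

theorem sub (h : Approx B g s) (h' : Approx B g' s') : Approx B (g - g') (s - s') := by
  have := dvd_sub h h'
  refine (Eq.subst ?_ this : X ^ (B + 1) ∣ _)
  rw [TrivSqZeroExt.fst_sub, TrivSqZeroExt.snd_sub, map_sub, map_sub]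
  ring

theorem mul (hB : 1 ≤ B) (h : Approx B g s) (h' : Approx B g' s') : Approx B (g * g') (s * s') := by
  obtain ⟨u, hu⟩ := h
  obtain ⟨u', hu'⟩ := h'
  rw [sub_eq_iff_eq_add] at hu hu'
  obtain ⟨b, rfl⟩ : ∃ b, B = b + 1 := ⟨B - 1, by omega⟩
  refine ⟨u * g' + (C s.fst - C s.snd * X ^ (b + 1)) * u' + C (s.snd * s'.snd) * X ^ b, ?_⟩
  rw [hu, hu', TrivSqZeroExt.fst_mul, TrivSqZeroExt.snd_mul]
  simp only [map_mul, map_add, smul_eq_mul, MulOpposite.smul_eq_mul_unop, MulOpposite.unop_op]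
  ring

theorem one : Approx B 1 1 := by simp [Approx]

theorem prod (hB : 1 ≤ B) {ι : Type*} (t : Finset ι) {f : ι → ℚ[X]} {c : ι → DefBase}
    (h : ∀ i ∈ t, Approx B (f i) (c i)) : Approx B (∏ i ∈ t, f i) (∏ i ∈ t, c i) := by
  classical
  induction t using Finset.induction_on with
  | empty => simpa using one
  | insert a t ha ih =>
    rw [Finset.prod_insert ha, Finset.prod_insert ha]
    exact (h a (Finset.mem_insert_self _ _)).mul hB
      (ih fun i hi => h i (Finset.mem_insert_of_mem hi))

theorem coeff_zero (hB : 1 ≤ B) (h : Approx B g s) : g.coeff 0 = s.fst := by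
  have := X_pow_dvd_iff.1 h 0 (by omega)
  rw [coeff_sub, sub_eq_zero] at this
  rw [this]
  simp [coeff_X_pow, show ¬ 0 = B by omega]

theorem coeff_self (hB : 1 ≤ B) (h : Approx B g s) : g.coeff B = - s.snd := by
  have := X_pow_dvd_iff.1 h B (by omega)
  rw [coeff_sub, sub_eq_zero] at this
  rw [this]
  simp [coeff_C, show ¬ B = 0 by omega]

theorem coeff_eq_zero (h : Approx B g s) (hs : s.fst = 0) {i : ℕ} (hi : i < B) : g.coeff i = 0 := by
  have := X_pow_dvd_iff.1 h i (by omega)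
  rw [coeff_sub, sub_eq_zero] at this
  rw [this, hs]
  simp [coeff_X_pow, hi.ne]

end Approx

/-- The weight `ε` of a vertex with a leaf neighbor. -/
def epsWeight : DefRing := TrivSqZeroExt.inr (1, 0)

/-- The weight in `DefRing` of a vertex with `m` leaf neighbors. -/
def leafWeight (m : ℕ) : DefRing := if m = 0 then deepWeight else epsWeight

theorem deepWeight_pow (k : ℕ) :
    deepWeight ^ k = TrivSqZeroExt.inl 1 + TrivSqZeroExt.inr (0, (k : DefBase)) := by
  induction k with
  | zero =>
    refine DefRing.ext' ?_ ?_ ?_ <;> simp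
  | succ k ih =>
    rw [pow_succ, ih]
    refine DefRing.ext' ?_ ?_ ?_ <;> simp [deepWeight]
    ring

theorem defFunctional_deepWeight_pow (k : ℕ) :
    defFunctional (deepWeight ^ k) = TrivSqZeroExt.inl 1 + TrivSqZeroExt.inr ((k : ℚ) - 1) := by
  rw [deepWeight_pow]
  refine TrivSqZeroExt.ext ?_ ?_ <;> simp [defFunctional]
  ring

theorem epsWeight_mul_deepWeight_pow (k : ℕ) : epsWeight * deepWeight ^ k = epsWeight := by
  rw [deepWeight_pow]
  refine DefRing.ext' ?_ ?_ ?_ <;> simp [epsWeight]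

theorem epsWeight_mul_self : epsWeight * epsWeight = 0 := by
  refine DefRing.ext' ?_ ?_ ?_ <;> simp [epsWeight]

theorem defFunctional_epsWeight : defFunctional epsWeight = 1 := by
  simp [defFunctional, epsWeight]

theorem exists_factor_of_terms {B D k M : ℕ} {c : ℕ → ℚ} {s : DefBase} (hk : k ≠ 0)
    (h0 : c 0 = 1) (hs : s.snd = 0)
    (hM : (s.fst = 1 ∧ digitWeight B M = D) ∨ (s.fst = 0 ∧ D + (B + 1) ≤ digitWeight B M))
    (hM' : ∀ j, 1 ≤ j → D + (B + 1) ≤ digitWeight B (M + j)) :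
    ∃ g : ℚ[X], ∑ j ∈ Finset.range k, c j • (X ^ digitWeight B (M + j) : ℚ[X]) = X ^ D * g ∧
      Approx B g s := by
  obtain ⟨k, rfl⟩ := Nat.exists_eq_succ_of_ne_zero hk
  obtain ⟨u, hu⟩ : (X ^ (D + (B + 1)) : ℚ[X]) ∣ ∑ j ∈ Finset.range k,
      c (j + 1) • (X ^ digitWeight B (M + (j + 1)) : ℚ[X]) :=
    Finset.dvd_sum fun j _ => by
      rw [smul_eq_C_mul]
      exact Dvd.dvd.mul_left (pow_dvd_pow _ (hM' _ (by omega))) _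
  rw [Finset.sum_range_succ', hu, h0, one_smul, add_zero]
  rcases hM with ⟨h1, h2⟩ | ⟨h1, h2⟩
  · refine ⟨X ^ (B + 1) * u + 1, ?_, u, ?_⟩
    · rw [h2]
      ring
    · rw [h1, hs]
      simp
  · obtain ⟨e, he⟩ := Nat.exists_eq_add_of_le h2
    refine ⟨X ^ (B + 1) * (u + X ^ e), ?_, u + X ^ e, ?_⟩
    · rw [he]
      ring
    · rw [h1, hs]
      simp

variable {V : Type*} [Fintype V]

theorem exists_block_factor {B : ℕ} (hB : Fintype.card V + 3 ≤ B) (L : V → ℕ) {K : Finset V}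
    (hK : K.Nonempty) : ∃ g : ℚ[X],
      starFunctional B (∏ v ∈ K, (X * (1 - X) ^ L v)) =
        X ^ (∑ v ∈ K, digitWeight B (L v)) * g ∧
      Approx B g (defFunctional (∏ v ∈ K, leafWeight (L v))) := by
  classical
  have hk := Finset.card_ne_zero.2 hK
  rw [Finset.prod_mul_distrib, Finset.prod_const, Finset.prod_pow_eq_pow_sum,
    starFunctional_pow_mul B hk]
  have hsplit : ∏ v ∈ K, leafWeight (L v) =
      epsWeight ^ (K.filter fun v => ¬ L v = 0).card *
        deepWeight ^ (K.filter fun v => L v = 0).card := by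
    simp only [leafWeight]
    rw [Finset.prod_ite, Finset.prod_const, Finset.prod_const]
    exact mul_comm (G := DefRing) _ _
  have hstep : ∀ m j, 1 ≤ m → 1 ≤ j → B ^ m + (B + 1) ≤ digitWeight B (m + j) := by
    intro m j hm hj
    rw [digitWeight, if_neg (by omega)]
    have h1 : B ^ (m + 1) ≤ B ^ (m + j) := Nat.pow_le_pow_right (by omega) (by omega)
    have h2 : B ^ 1 ≤ B ^ m := Nat.pow_le_pow_right (by omega) hm
    rw [pow_succ] at h1
    nlinarith
  rcases Nat.lt_or_ge (K.filter fun v => ¬ L v = 0).card 1 with hc | hc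
  · have hL : ∀ v ∈ K, L v = 0 := by
      intro v hv
      by_contra hne
      have := Finset.card_eq_zero.1 (Nat.lt_one_iff.1 hc)
      exact Finset.notMem_empty v (this ▸ Finset.mem_filter.2 ⟨hv, hne⟩)
    have hM : ∑ v ∈ K, L v = 0 := Finset.sum_eq_zero hL
    have hD : ∑ v ∈ K, digitWeight B (L v) = 0 :=
      Finset.sum_eq_zero fun v hv => by rw [hL v hv, digitWeight, if_pos rfl]
    have hdeep : K.filter (fun v => L v = 0) = K := Finset.filter_true_of_mem hL
    refine ⟨_, by rw [hD, pow_zero, one_mul], ?_⟩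
    rw [hsplit, Nat.lt_one_iff.1 hc, pow_zero, one_mul, hdeep, defFunctional_deepWeight_pow, hM]
    obtain ⟨k, hk'⟩ := Nat.exists_eq_succ_of_ne_zero hk
    rw [hk']
    cases k with
    | zero => simp [Approx, digitWeight]
    | succ k =>
      obtain ⟨u, hu⟩ : (X ^ (B + 1) : ℚ[X]) ∣ ∑ j ∈ Finset.range k,
          ((-1) ^ (j + 1 + 1) * ((k + 1).choose (j + 1 + 1) : ℚ)) •
            (X ^ digitWeight B (0 + (j + 1 + 1)) : ℚ[X]) := by
        refine Finset.dvd_sum fun j _ => ?_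
        rw [smul_eq_C_mul]
        refine Dvd.dvd.mul_left (pow_dvd_pow _ ?_) _
        have := hstep 1 (j + 1) le_rfl (by omega)
        rw [show 0 + (j + 1 + 1) = 1 + (j + 1) by omega]
        omega
      rw [Finset.sum_range_succ', Finset.sum_range_succ']
      simp only [Nat.succ_eq_add_one, Nat.add_sub_cancel]
      rw [hu]
      refine ⟨u, ?_⟩
      simp [digitWeight, smul_eq_C_mul]
      ring
  · rcases Nat.lt_or_ge (K.filter fun v => ¬ L v = 0).card 2 with hc' | hc'
    · obtain ⟨x, hx⟩ := Finset.card_eq_one.1 (le_antisymm (by omega) hc)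
      have hxK : x ∈ K ∧ ¬ L x = 0 := Finset.mem_filter.1 (hx ▸ Finset.mem_singleton_self x)
      have hL : ∀ v ∈ K, v ≠ x → L v = 0 := by
        intro v hv hvx
        by_contra hne
        exact hvx (Finset.mem_singleton.1 (hx ▸ Finset.mem_filter.2 ⟨hv, hne⟩))
      have hM : ∑ v ∈ K, L v = L x := Finset.sum_eq_single_of_mem x hxK.1 hL
      have hD : ∑ v ∈ K, digitWeight B (L v) = digitWeight B (L x) :=
        Finset.sum_eq_single_of_mem x hxK.1 fun v hv hvx => by
          rw [hL v hv hvx, digitWeight, if_pos rfl]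
      rw [hsplit, show (K.filter fun v => ¬ L v = 0).card = 1 by omega, pow_one,
        epsWeight_mul_deepWeight_pow, defFunctional_epsWeight, hM, hD]
      refine exists_factor_of_terms hk (by simp) (by simp) (Or.inl ⟨by simp, rfl⟩) fun j hj => ?_
      conv_lhs => rw [digitWeight, if_neg hxK.2]
      exact hstep _ _ (by omega) hj
    · obtain ⟨c, hcc⟩ := Nat.exists_eq_add_of_le hc'
      rw [hsplit, hcc, pow_add, pow_two, epsWeight_mul_self, zero_mul, zero_mul, map_zero]
      set M := ∑ v ∈ K, L v with hMdef
      have hbound : ∀ v ∈ K, L v + 1 ≤ M := by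
        intro v hv
        obtain ⟨y, hy, hyv⟩ := Finset.exists_mem_ne
          (by omega : 1 < (K.filter fun v => ¬ L v = 0).card) v
        rw [Finset.mem_filter] at hy
        have h1 := Finset.add_sum_erase K L hv
        have h2 : L y ≤ ∑ w ∈ K.erase v, L w :=
          Finset.single_le_sum (f := L) (fun _ _ => Nat.zero_le _)
            (Finset.mem_erase.2 ⟨hyv, hy.1⟩)
        omega
      have hM2 : 2 ≤ M := by
        obtain ⟨y, hy⟩ := Finset.card_pos.1 (by omega : 0 < (K.filter fun v => ¬ L v = 0).card)
        rw [Finset.mem_filter] at hy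
        have := hbound y hy.1
        omega
      have hD : ∑ v ∈ K, digitWeight B (L v) ≤ Fintype.card V * B ^ (M - 1) := by
        refine (Finset.sum_le_card_nsmul K _ (B ^ (M - 1)) fun v hv => ?_).trans ?_
        · have := hbound v hv
          refine (digitWeight_mono (j := M - 1) (by omega) (by omega)).trans ?_
          rw [digitWeight, if_neg (by omega)]
        · rw [smul_eq_mul]
          exact Nat.mul_le_mul_right _ (Finset.card_le_univ K)
      have hBM : ∀ j, ∑ v ∈ K, digitWeight B (L v) + (B + 1) ≤ digitWeight B (M + j) := by
        intro j
        refine le_trans ?_ (digitWeight_mono (i := M) (by omega) (by omega))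
        rw [digitWeight, if_neg (by omega)]
        have h1 : B ^ M = B ^ (M - 1) * B := by rw [← pow_succ]; congr 1; omega
        have h2 : B ^ 1 ≤ B ^ (M - 1) := Nat.pow_le_pow_right (by omega) (by omega)
        rw [h1]
        nlinarith
      exact exists_factor_of_terms hk (by simp) (by simp) (Or.inr ⟨by simp, hBM 0⟩)
        fun j _ => hBM j

/-- The leading behavior of the deletion–contraction sum with weights `x (1 - x) ^ L v`. -/
theorem exists_delContr_factor {B : ℕ} (hB : Fintype.card V + 3 ≤ B) (L : V → ℕ)
    (es : List (V × V)) : ∃ g : ℚ[X],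
      delContr (blockWeight (starFunctional B) fun v => X * (1 - X) ^ L v) es ⊥ =
        X ^ (∑ v, digitWeight B (L v)) * g ∧
      Approx B g (delContr (blockWeight (S := DefBase) defFunctional
        fun v => leafWeight (L v)) es ⊥) := by
  refine delContr_rel (fun x y => ∃ g : ℚ[X], x = X ^ (∑ v, digitWeight B (L v)) * g ∧ Approx B g y)
    ?_ (fun r => ?_) es ⊥
  · rintro _ _ c d ⟨g, rfl, hg⟩ ⟨g', rfl, hg'⟩
    exact ⟨g - g', by ring, hg.sub hg'⟩
  · have hblock : ∀ K : Finset V, ∃ g : ℚ[X], K ∈ blocks r →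
        starFunctional B (∏ v ∈ K, (X * (1 - X) ^ L v)) =
          X ^ (∑ v ∈ K, digitWeight B (L v)) * g ∧
        Approx B g (defFunctional (∏ v ∈ K, leafWeight (L v))) := by
      intro K
      by_cases hK : K ∈ blocks r
      · obtain ⟨v, rfl⟩ := mem_blocks.1 hK
        obtain ⟨g, hg⟩ := exists_block_factor hB L (block_nonempty r v)
        exact ⟨g, fun _ => hg⟩
      · exact ⟨0, fun h => absurd h hK⟩
    choose g hg using hblock
    refine ⟨∏ K ∈ blocks r, g K, ?_, Approx.prod (by omega) _ fun K hK => (hg K hK).2⟩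
    rw [blockWeight, Finset.prod_congr rfl fun K hK => (hg K hK).1, Finset.prod_mul_distrib,
      Finset.prod_pow_eq_pow_sum, sum_blocks]

end StarFunctional

section ListSums

/-- The derivative-like sum `∑ᵢ αᵢ ∏_{j ≠ i} βⱼ` along a list. -/
def mixedSum {V : Type*} (α β : V → ℚ) : List V → ℚ
  | [] => 0
  | v :: l => α v * (l.map β).prod + β v * mixedSum α β l

variable {V : Type*} {α β : V → ℚ}

theorem prod_le_prod_add (hα : ∀ v, 0 ≤ α v) (hβ : ∀ v, 0 ≤ β v) (l : List V) :
    0 ≤ (l.map β).prod ∧ (l.map β).prod ≤ (l.map fun v => α v + β v).prod := by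
  induction l with
  | nil => simp
  | cons v l ih =>
    simp only [List.map_cons, List.prod_cons]
    exact ⟨mul_nonneg (hβ v) ih.1, mul_le_mul (by linarith [hα v]) ih.2 ih.1
      (add_nonneg (hα v) (hβ v))⟩

theorem prod_lt_prod_add (hα : ∀ v, 0 ≤ α v) (hβ : ∀ v, 0 ≤ β v) (hαβ : ∀ v, 0 < α v + β v)
    {l : List V} (h : ∃ v ∈ l, 0 < α v) :
    (l.map β).prod < (l.map fun v => α v + β v).prod := by
  induction l with
  | nil => simp at h
  | cons v l ih =>
    obtain ⟨h1, h2⟩ := prod_le_prod_add hα hβ l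
    have hpos : 0 < (l.map fun v => α v + β v).prod :=
      List.prod_pos (by simpa using fun a _ => hαβ a)
    simp only [List.map_cons, List.prod_cons]
    by_cases hv : 0 < α v
    · nlinarith [mul_pos hv hpos, mul_le_mul_of_nonneg_left h2 (hβ v)]
    · obtain ⟨x, hx, hxα⟩ := h
      have hv0 : α v = 0 := le_antisymm (not_lt.1 hv) (hα v)
      have hx' : x ∈ l := by
        rcases List.mem_cons.1 hx with rfl | hx
        · exact absurd hxα hv
        · exact hx
      have h3 := ih ⟨x, hx', hxα⟩
      have hβv : 0 < β v := by simpa [hv0] using hαβ v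
      rw [hv0, zero_add]
      exact mul_lt_mul_of_pos_left h3 hβv

theorem mixedSum_bound (hα : ∀ v, 0 ≤ α v) (hβ : ∀ v, 0 ≤ β v) (hαβ : ∀ v, 0 < α v + β v)
    (l : List V) :
    mixedSum α β l + (l.map β).prod ≤ (l.map fun v => α v + β v).prod ∧
    (2 ≤ l.countP (fun v => 0 < α v) →
      mixedSum α β l + (l.map β).prod < (l.map fun v => α v + β v).prod) := by
  induction l with
  | nil => simp [mixedSum]
  | cons v l ih =>
    obtain ⟨ih1, ih2⟩ := ih
    obtain ⟨h1, h2⟩ := prod_le_prod_add hα hβ l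
    simp only [List.map_cons, List.prod_cons, mixedSum]
    have e1 := mul_le_mul_of_nonneg_left ih1 (hβ v)
    have e2 := mul_le_mul_of_nonneg_left h2 (hα v)
    refine ⟨by nlinarith, fun hc => ?_⟩
    by_cases hv : 0 < α v
    · have : 1 ≤ l.countP fun v => 0 < α v := by
        rw [List.countP_cons_of_pos (by simpa using hv)] at hc
        omega
      obtain ⟨x, hx, hxα⟩ := List.countP_pos_iff.1 this
      have h3 := mul_lt_mul_of_pos_left
        (prod_lt_prod_add hα hβ hαβ ⟨x, hx, by simpa using hxα⟩) hv
      nlinarith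
    · rw [List.countP_cons_of_neg (by simpa using hv)] at hc
      have hv0 : α v = 0 := le_antisymm (not_lt.1 hv) (hα v)
      have hβv : 0 < β v := by simpa [hv0] using hαβ v
      have h3 := mul_lt_mul_of_pos_left (ih2 hc) hβv
      nlinarith

end ListSums

section CycleNonvanishing

variable {V : Type*}

theorem parts_list_prod {z : V → DefRing} {α β γ : V → ℚ} {l : List V}
    (hz : ∀ v ∈ l, constPart (z v) = - (γ v * β v) ∧ epsPart (z v) = γ v * α v) :
    constPart (l.map z).prod = (-1) ^ l.length * (l.map γ).prod * (l.map β).prod ∧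
    epsPart (l.map z).prod = - ((-1) ^ l.length * (l.map γ).prod * mixedSum α β l) := by
  induction l with
  | nil => simp [constPart, epsPart, mixedSum]
  | cons v l ih =>
    obtain ⟨ih1, ih2⟩ := ih fun v hv => hz v (List.mem_cons_of_mem _ hv)
    obtain ⟨h1, h2⟩ := hz v List.mem_cons_self
    simp only [List.map_cons, List.prod_cons, List.length_cons, mixedSum]
    rw [constPart_mul, epsPart_mul, ih1, ih2, h1, h2, pow_succ]
    constructor <;> ring

/-- The weighted cycle sum in closed form. -/
theorem fst_cycleValue_map {z : V → DefRing} {α β γ : V → ℚ} {w : V} {l : List V}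
    (hz : ∀ v ∈ w :: l, constPart (z v) = - (γ v * β v) ∧ epsPart (z v) = γ v * α v) :
    (cycleValue (S := DefBase) defFunctional (z w) (l.map z)).fst =
      ((w :: l).map γ).prod * (((w :: l).map fun v => α v + β v).prod -
        (mixedSum α β (w :: l) + ((w :: l).map β).prod)) := by
  obtain ⟨h1, h2⟩ := parts_list_prod hz
  have h3 : ∀ l : List V, (∀ v ∈ l, constPart (z v) = - (γ v * β v) ∧ epsPart (z v) = γ v * α v) →
      ((l.map z).map cycleChar).prod = (l.map γ).prod * (l.map fun v => α v + β v).prod := by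
    intro l hl
    rw [List.map_map, ← List.prod_map_mul]
    congr 1
    refine List.map_congr_left fun v hv => ?_
    rw [Function.comp_apply, cycleChar, (hl v hv).1, (hl v hv).2]
    ring
  have h4 := h3 _ hz
  rw [fst_cycleValue]
  have h5 : z w * (l.map z).prod = ((w :: l).map z).prod := by simp
  have h6 : cycleChar (z w) * ((l.map z).map cycleChar).prod =
      (((w :: l).map z).map cycleChar).prod := by simp
  have h7 : ((-1 : ℚ) ^ (l.length + 1)) * (-1) ^ (l.length + 1) = 1 := by
    rw [← mul_pow]
    simp
  rw [h5, h6, h4, cycleChar, h1, h2, List.length_map, List.length_cons]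
  linear_combination (-(((w :: l).map γ).prod * (mixedSum α β (w :: l) +
    ((w :: l).map β).prod))) * h7

theorem cycleValue_fst_ne_zero {z : V → DefRing} {α β γ : V → ℚ} {w : V} {l : List V}
    (hα : ∀ v, 0 ≤ α v) (hβ : ∀ v, 0 ≤ β v) (hαβ : ∀ v, 0 < α v + β v) (hγ : ∀ v, γ v ≠ 0)
    (hz : ∀ v ∈ w :: l, constPart (z v) = - (γ v * β v) ∧ epsPart (z v) = γ v * α v)
    (hc : 2 ≤ (w :: l).countP (fun v => 0 < α v)) :
    (cycleValue (S := DefBase) defFunctional (z w) (l.map z)).fst ≠ 0 := by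
  rw [fst_cycleValue_map hz]
  refine mul_ne_zero ?_ (sub_pos.2 ((mixedSum_bound hα hβ hαβ _).2 hc)).ne'
  refine List.prod_ne_zero ?_
  simp only [List.mem_map, not_exists, not_and]
  exact fun v _ => hγ v

theorem cycleValue_of_single {z : V → DefRing} {a b c : ℚ} {w : V} {l : List V}
    (hl : 2 ≤ l.length) (ha : 0 ≤ a) (hab : 0 < a + b) (hc : c ≠ 0)
    (hw : constPart (z w) = - (c * b) ∧ epsPart (z w) = c * a) (hz : ∀ v ∈ l, z v = deepWeight) :
    (cycleValue (S := DefBase) defFunctional (z w) (l.map z)).fst = 0 ∧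
      (cycleValue (S := DefBase) defFunctional (z w) (l.map z)).snd ≠ 0 := by
  obtain ⟨k, hk⟩ : ∃ k, l.length = k + 1 + 1 := ⟨l.length - 2, by omega⟩
  have hrep : l.map z = List.replicate (k + 1 + 1) deepWeight := by
    rw [List.eq_replicate_iff]
    refine ⟨by simpa using hk, ?_⟩
    simpa using hz
  rw [hrep, cycleValue_deep, hw.1, hw.2]
  constructor
  · simp
  · have : 0 < b + (k + 1 : ℚ) * a := by
      have : 0 ≤ (k : ℚ) * a := mul_nonneg (Nat.cast_nonneg k) ha
      linarith
    simp only [TrivSqZeroExt.snd_smul, DualNumber.snd_eps, smul_eq_mul, mul_one]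
    refine mul_ne_zero (pow_ne_zero _ (by norm_num)) ?_
    have h2 : -(c * b) - ((k + 1 : ℕ) : ℚ) * (c * a) = -(c * (b + (k + 1 : ℚ) * a)) := by
      push_cast
      ring
    rw [h2]
    exact neg_ne_zero.2 (mul_ne_zero hc this.ne')

end CycleNonvanishing

section TreePeeling

open Polynomial

variable {V : Type*}

/-- The edges joining the vertices of `T` to their parents. -/
noncomputable def treePairs (par : V → V) (T : Finset V) : List (V × V) :=
  T.toList.map fun u => (u, par u)

theorem mem_treePairs {par : V → V} {T : Finset V} {e : V × V} :
    e ∈ treePairs par T ↔ e.1 ∈ T ∧ e.2 = par e.1 := by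
  obtain ⟨a, b⟩ := e
  simp only [treePairs, List.mem_map, Finset.mem_toList, Prod.mk.injEq]
  constructor
  · rintro ⟨u, hu, rfl, rfl⟩
    exact ⟨hu, rfl⟩
  · rintro ⟨ha, rfl⟩
    exact ⟨a, ha, rfl, rfl⟩

variable [DecidableEq V]

theorem treePairs_perm (par : V → V) {T : Finset V} {u : V} (hu : u ∈ T) :
    (treePairs par T).Perm ((u, par u) :: treePairs par (T.erase u)) := by
  have h := Finset.toList_insert (Finset.notMem_erase u T)
  rw [Finset.insert_erase hu] at h
  exact h.map _

/-- The number of vertices of `s` with parent `v`. -/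
def childCount (par : V → V) (s : Finset V) (v : V) : ℕ := (s.filter fun u => par u = v).card

theorem childCount_insert {par : V → V} {s : Finset V} {u : V} (hu : u ∉ s) (v : V) :
    childCount par (insert u s) v = childCount par s v + if par u = v then 1 else 0 := by
  unfold childCount
  rw [Finset.filter_insert]
  split_ifs with h
  · rw [Finset.card_insert_of_notMem]
    exact fun h' => hu (Finset.mem_filter.1 h').1
  · rw [add_zero]

variable [Fintype V]
variable {S R : Type*} [CommRing S] [CommRing R] [Algebra S R]

theorem delContr_peel_tree (φ : R →ₗ[S] S) (z : V → R) {η : R} (hη : φ η = 1) {par : V → V}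
    {T : Finset V} {es : List (V × V)} {u : V} (hu : u ∈ T) (hpar : par u ≠ u)
    (hch : ∀ x ∈ T, par x ≠ u) (hes : ∀ e ∈ es, e.1 ≠ u ∧ e.2 ≠ u) :
    delContr (blockWeight φ z) (treePairs par T ++ es) ⊥ =
      delContr (blockWeight φ (Function.update (Function.update z (par u)
        (z (par u) * (algebraMap S R (φ (z u)) - z u))) u η))
        (treePairs par (T.erase u) ++ es) ⊥ := by
  rw [delContr_perm _ ((treePairs_perm par hu).append_right es), List.cons_append]
  refine delContr_peel φ z hη (fun e he => ?_) hpar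
  rcases List.mem_append.1 he with he | he
  · obtain ⟨h1, h2⟩ := mem_treePairs.1 he
    rw [Finset.mem_erase] at h1
    exact ⟨h1.1, h2 ▸ hch _ h1.2⟩
  · exact hes e he

theorem delContr_peel_leaves (B : ℕ) {par : V → V} {U s : Finset V} {es : List (V × V)}
    (hs : s ⊆ U) (hpar : ∀ u ∈ U, par u ≠ u) (hch : ∀ u ∈ s, ∀ x ∈ U, par x ≠ u)
    (hes : ∀ u ∈ s, ∀ e ∈ es, e.1 ≠ u ∧ e.2 ≠ u) :
    delContr (blockWeight (starFunctional B) fun _ : V => X) (treePairs par U ++ es) ⊥ =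
      delContr (blockWeight (starFunctional B) fun v => X * (1 - X) ^ childCount par s v)
        (treePairs par (U \ s) ++ es) ⊥ := by
  induction s using Finset.induction_on with
  | empty => simp [childCount]
  | insert u s hu ih =>
    have hu' := Finset.mem_insert_self u s
    rw [ih (fun x hx => hs (Finset.mem_insert_of_mem hx))
      (fun x hx => hch x (Finset.mem_insert_of_mem hx))
      (fun x hx => hes x (Finset.mem_insert_of_mem hx)),
      delContr_peel_tree (starFunctional B) _ (starFunctional_X B)
        (Finset.mem_sdiff.2 ⟨hs hu', hu⟩) (hpar u (hs hu'))
        (fun x hx => hch u hu' x (Finset.mem_sdiff.1 hx).1) (hes u hu')]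
    have h0 : childCount par s u = 0 := by
      rw [childCount, Finset.card_eq_zero, Finset.filter_eq_empty_iff]
      exact fun x hx => hch u hu' x (hs (Finset.mem_insert_of_mem hx))
    rw [Finset.sdiff_insert]
    congr 2
    funext v
    rw [childCount_insert hu]
    by_cases hv : v = u
    · subst hv
      rw [Function.update_self, h0, if_neg (hpar v (hs hu'))]
      simp
    · rw [Function.update_of_ne hv]
      by_cases hv' : par u = v
      · subst hv'
        rw [Function.update_self, if_pos rfl, h0, pow_zero, mul_one, starFunctional_X, map_one,
          pow_succ, mul_assoc]
      · rw [Function.update_of_ne (Ne.symm hv'), if_neg hv', add_zero]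

/-- The shape of the vertex weights once all the descendants outside `T` have been peeled off:
`L` counts leaf neighbors and `k` counts peeled children. -/
def PeelInvariant (L k : V → ℕ) (T : Finset V) (z : V → DefRing) : Prop :=
  ∀ v ∈ T, ∃ c : ℚ, c ≠ 0 ∧ (L v ≠ 0 → constPart (z v) = 0 ∧ epsPart (z v) = c) ∧
    (L v = 0 → constPart (z v) = c ∧ epsPart (z v) = - (c * k v)) ∧
    (L v = 0 → k v = 0 → z v = deepWeight)

theorem exists_peel_core {par : V → V} {ht : V → ℕ} {L : V → ℕ} {U₀ Cy : Finset V}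
    {es : List (V × V)} (hpar : ∀ u ∈ U₀, ht (par u) < ht u)
    (hdisj : Disjoint U₀ Cy)
    (hdeep : ∀ u ∈ U₀, L u = 0 → ∃ x ∈ U₀, par x = u)
    (hes : ∀ e ∈ es, e.1 ∈ Cy ∧ e.2 ∈ Cy) (T : Finset V) (hT : T ⊆ U₀)
    (hdown : ∀ u ∈ T, par u ∈ T ∨ par u ∈ Cy) (z : V → DefRing)
    (hz : PeelInvariant L (childCount par (U₀ \ T)) (T ∪ Cy) z)
    (hz1 : ∀ v ∉ T ∪ Cy, defFunctional (z v) = 1) :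
    ∃ z' : V → DefRing, PeelInvariant L (childCount par U₀) Cy z' ∧
      (∀ v ∉ Cy, defFunctional (z' v) = 1) ∧
      delContr (blockWeight (S := DefBase) defFunctional z) (treePairs par T ++ es) ⊥ =
        delContr (blockWeight (S := DefBase) defFunctional z') es ⊥ := by
  induction hn : T.card generalizing T z with
  | zero =>
    obtain rfl := Finset.card_eq_zero.1 hn
    rw [Finset.empty_union] at hz hz1
    rw [Finset.sdiff_empty] at hz
    exact ⟨z, hz, hz1, by simp [treePairs]⟩
  | succ n ih =>
    obtain ⟨u, hu, hmax⟩ := Finset.exists_max_image T ht (Finset.card_pos.1 (by omega))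
    have huU := hT hu
    have huCy : u ∉ Cy := fun h => Finset.disjoint_left.1 hdisj huU h
    have hch : ∀ x ∈ T, par x ≠ u := fun x hx h => by
      have h1 := hpar x (hT hx)
      have h2 := hmax x hx
      rw [h] at h1
      omega
    have hpu : par u ≠ u := fun h => by
      have := hpar u huU
      rw [h] at this
      omega
    have hpu' : par u ∈ T ∪ Cy := Finset.mem_union.2 (hdown u hu)
    have huT' : u ∉ U₀ \ T := fun h => (Finset.mem_sdiff.1 h).2 hu
    have hsd : U₀ \ T.erase u = insert u (U₀ \ T) := by
      ext x
      simp only [Finset.mem_sdiff, Finset.mem_erase, Finset.mem_insert]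
      by_cases hx : x = u
      · simp [hx, huU]
      · simp [hx]
    rw [delContr_peel_tree (S := DefBase) defFunctional z defFunctional_deepWeight hu hpu hch
      fun e he => ⟨fun h => huCy (h ▸ (hes e he).1), fun h => huCy (h ▸ (hes e he).2)⟩]
    refine ih (T.erase u) ((Finset.erase_subset _ _).trans hT) (fun x hx => ?_) _ ?_ ?_ ?_
    · rw [Finset.mem_erase] at hx
      exact (hdown x hx.2).imp_left fun h => Finset.mem_erase.2 ⟨hch x hx.2, h⟩
    · rw [hsd]
      intro v hv
      have hvu : v ≠ u := by
        rintro rfl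
        rcases Finset.mem_union.1 hv with h | h
        · exact Finset.notMem_erase _ _ h
        · exact huCy h
      have hvT : v ∈ T ∪ Cy := Finset.union_subset_union_left (Finset.erase_subset _ _) hv
      obtain ⟨c, hc, h1, h2, h3⟩ := hz v hvT
      rw [Function.update_of_ne hvu, childCount_insert huT']
      by_cases hv' : par u = v
      · subst hv'
        rw [Function.update_self, if_pos rfl]
        obtain ⟨a, ha, ha'⟩ : ∃ a : ℚ, a ≠ 0 ∧ epsPart (z u) = a := by
          obtain ⟨c', hc', h1', h2', -⟩ := hz u (Finset.mem_union_left _ hu)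
          by_cases hL : L u = 0
          · refine ⟨_, ?_, (h2' hL).2⟩
            obtain ⟨x, hx, hxu⟩ := hdeep u huU hL
            have hpos : 0 < childCount par (U₀ \ T) u := Finset.card_pos.2
              ⟨x, Finset.mem_filter.2 ⟨Finset.mem_sdiff.2 ⟨hx, fun h => hch x h hxu⟩, hxu⟩⟩
            exact neg_ne_zero.2 (mul_ne_zero hc' (by exact_mod_cast hpos.ne'))
          · exact ⟨c', hc', (h1' hL).2⟩
        refine ⟨c * a, mul_ne_zero hc ha, fun hL => ?_, fun hL => ?_, fun _ h0 => by omega⟩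
        · rw [constPart_mul, epsPart_mul, constPart_peel, epsPart_peel, (h1 hL).1, (h1 hL).2, ha']
          constructor <;> ring
        · rw [constPart_mul, epsPart_mul, constPart_peel, epsPart_peel, (h2 hL).1, (h2 hL).2, ha']
          push_cast
          constructor <;> ring
      · rw [Function.update_of_ne (Ne.symm hv'), if_neg hv', add_zero]
        exact ⟨c, hc, h1, h2, h3⟩
    · intro v hv
      by_cases hvu : v = u
      · rw [hvu, Function.update_self, defFunctional_deepWeight]
      · have hvT : v ∉ T ∪ Cy := fun h => hv <| by
          rcases Finset.mem_union.1 h with h | h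
          · exact Finset.mem_union_left _ (Finset.mem_erase.2 ⟨hvu, h⟩)
          · exact Finset.mem_union_right _ h
        rw [Function.update_of_ne hvu, Function.update_of_ne (fun h => hvT (by rw [h]; exact hpu'))]
        exact hz1 v hvT
    · rw [Finset.card_erase_of_mem hu, hn, Nat.add_sub_cancel]

end TreePeeling

section LeadingPartition

open Polynomial

theorem coeff_sum_partsWeight {n B : ℕ} (hB : n < B) (c : n.Partition → ℚ) (lam : n.Partition) :
    (∑ mu, c mu • (X ^ partsWeight B mu.parts : ℚ[X])).coeff (partsWeight B lam.parts) = c lam := by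
  rw [finsetSum_coeff, Finset.sum_eq_single lam]
  · simp
  · intro mu _ hmu
    rw [coeff_smul, coeff_X_pow, if_neg fun h => hmu (partsWeight_injective hB h).symm, smul_zero]
  · exact fun h => absurd (Finset.mem_univ _) h

theorem isLeadingPartition_of_factor {n B w₀ i : ℕ} (hB : n < B) {c : n.Partition → ℚ} {g : ℚ[X]}
    (hg : ∑ mu, c mu • (X ^ partsWeight B mu.parts : ℚ[X]) = X ^ w₀ * g)
    (hi : g.coeff i ≠ 0) (hlt : ∀ j < i, g.coeff j = 0) {lam : n.Partition}
    (hlam : partsWeight B lam.parts = w₀ + i) : IsLeadingPartition c lam := by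
  have key : ∀ mu, c mu = if w₀ ≤ partsWeight B mu.parts then
      g.coeff (partsWeight B mu.parts - w₀) else 0 := fun mu => by
    rw [← coeff_sum_partsWeight hB c mu, hg, coeff_X_pow_mul']
  refine ⟨?_, fun mu hmu => partitionLex_of_partsWeight_le hB ?_⟩
  · rw [key, hlam, if_pos (by omega), Nat.add_sub_cancel_left]
    exact hi
  · by_contra! hlt'
    rw [key] at hmu
    split_ifs at hmu with h
    · exact hmu (hlt _ (by omega))
    · exact hmu rfl

variable {V : Type*} [DecidableEq V]

/-- The vertices outside the cycle that have no children. -/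
def childless (par : V → V) (U : Finset V) : Finset V := U.filter fun u => ∀ x ∈ U, par x ≠ u

/-- Vertices of the cycle with a child. -/
def branching (par : V → V) (U Cy : Finset V) : Finset V := Cy.filter fun v => ∃ x ∈ U, par x = v

theorem mem_childless {par : V → V} {U : Finset V} {u : V} :
    u ∈ childless par U ↔ u ∈ U ∧ ∀ x ∈ U, par x ≠ u := by
  simp [childless]

theorem mem_branching {par : V → V} {U Cy : Finset V} {v : V} :
    v ∈ branching par U Cy ↔ v ∈ Cy ∧ ∃ x ∈ U, par x = v := by
  simp [branching]

theorem childCount_eq_zero_iff {par : V → V} {s : Finset V} {v : V} :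
    childCount par s v = 0 ↔ ∀ x ∈ s, par x ≠ v := by
  rw [childCount, Finset.card_eq_zero, Finset.filter_eq_empty_iff]

theorem childCount_childless {par : V → V} {U : Finset V} {v : V} (hv : v ∈ childless par U) :
    childCount par (childless par U) v = 0 :=
  childCount_eq_zero_iff.2 fun x hx => (mem_childless.1 hv).2 x (mem_childless.1 hx).1

variable [Fintype V]

theorem sum_childCount (par : V → V) (U : Finset V) :
    ∑ v ∈ (childless par U)ᶜ, (childCount par (childless par U) v + 1) = Fintype.card V := by
  have h1 : ∑ v, childCount par (childless par U) v = (childless par U).card :=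
    (Finset.card_eq_sum_card_fiberwise fun _ _ => Finset.mem_coe.2 (Finset.mem_univ _)).symm
  rw [← Finset.sum_compl_add_sum (childless par U), Finset.sum_eq_zero fun v hv =>
    childCount_childless hv, add_zero] at h1
  rw [Finset.sum_add_distrib, h1, Finset.sum_const, smul_eq_mul, mul_one, add_comm,
    Finset.card_compl_add_card]

theorem sum_digitWeight (B : ℕ) (par : V → V) (U : Finset V) :
    ∑ v, digitWeight B (childCount par (childless par U) v) =
      ∑ v ∈ (childless par U)ᶜ, digitWeight B (childCount par (childless par U) v) := by
  rw [← Finset.sum_compl_add_sum (childless par U), Finset.sum_eq_zero (s := childless par U),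
    add_zero]
  intro v hv
  rw [childCount_childless hv, digitWeight, if_pos rfl]

/-- The partition into the stars obtained by deleting all edges that contain no leaf. -/
def leafPartition (par : V → V) (U : Finset V) : (Fintype.card V).Partition where
  parts := (childless par U)ᶜ.val.map fun v => childCount par (childless par U) v + 1
  parts_pos := by
    intro i hi
    obtain ⟨v, _, rfl⟩ := Multiset.mem_map.1 hi
    exact Nat.succ_pos _
  parts_sum := sum_childCount par U

theorem partsWeight_leafPartition (B : ℕ) (par : V → V) (U : Finset V) :
    partsWeight B (leafPartition par U).parts =
      ∑ v, digitWeight B (childCount par (childless par U) v) := by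
  rw [sum_digitWeight, partsWeight, leafPartition, Multiset.map_map]
  rfl

theorem card_leafPartition (par : V → V) (U : Finset V) :
    (leafPartition par U).parts.card + (childless par U).card = Fintype.card V := by
  rw [leafPartition, Multiset.card_map]
  exact Finset.card_compl_add_card _

/-- Two parts equal to one can be merged. -/
theorem exists_mergedPartition {par : V → V} {U : Finset V} (B : ℕ) {x y : V} (hxy : x ≠ y)
    (hx : x ∉ childless par U) (hy : y ∉ childless par U)
    (hx0 : childCount par (childless par U) x = 0) (hy0 : childCount par (childless par U) y = 0) :
    ∃ lam : (Fintype.card V).Partition,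
      partsWeight B lam.parts = ∑ v, digitWeight B (childCount par (childless par U) v) + B ∧
      lam.parts.card + (childless par U).card + 1 = Fintype.card V := by
  have hx' : x ∈ (childless par U)ᶜ := Finset.mem_compl.2 hx
  have hy' : y ∈ (childless par U)ᶜ.erase x :=
    Finset.mem_erase.2 ⟨hxy.symm, Finset.mem_compl.2 hy⟩
  refine ⟨⟨2 ::ₘ (((childless par U)ᶜ.erase x).erase y).val.map fun v =>
    childCount par (childless par U) v + 1, ?_, ?_⟩, ?_, ?_⟩
  · intro i hi
    rcases Multiset.mem_cons.1 hi with rfl | hi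
    · norm_num
    · obtain ⟨v, _, rfl⟩ := Multiset.mem_map.1 hi
      exact Nat.succ_pos _
  · have h := sum_childCount par U
    rw [← Finset.add_sum_erase _ _ hx', ← Finset.add_sum_erase _ _ hy', hx0, hy0] at h
    rw [Multiset.sum_cons]
    change 2 + ∑ v ∈ ((childless par U)ᶜ.erase x).erase y,
      (childCount par (childless par U) v + 1) = _
    omega
  · have h := sum_digitWeight B par U
    rw [← Finset.add_sum_erase _ _ hx', ← Finset.add_sum_erase _ _ hy', hx0, hy0] at h
    have h1 : digitWeight B 1 = B := by simp [digitWeight]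
    have h0 : digitWeight B 0 = 0 := by simp [digitWeight]
    rw [h, partsWeight, Multiset.map_cons, Multiset.sum_cons, Multiset.map_map]
    change digitWeight B 1 + ∑ v ∈ ((childless par U)ᶜ.erase x).erase y,
      digitWeight B (childCount par (childless par U) v) = _
    omega
  · have h1 := Finset.card_erase_add_one hx'
    have h2 := Finset.card_erase_add_one hy'
    have h3 := Finset.card_compl_add_card (childless par U)
    rw [Multiset.card_cons, Multiset.card_map]
    change (((childless par U)ᶜ.erase x).erase y).card + 1 + _ + 1 = _
    omega

/-- The number of parts of the leading partition, in terms of a rooted forest attached to a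
cycle. -/
theorem card_parts_leadingPartition {G : SimpleGraph V} {w : V} {l : List V} {par : V → V}
    {ht : V → ℕ} {U : Finset V} (hnd : (l ++ [w]).Nodup) (hlen : 2 ≤ l.length)
    (hU : U = (l ++ [w]).toFinsetᶜ) (hpar : ∀ u ∈ U, ht (par u) < ht u)
    (hes : EnumeratesEdges G (treePairs par U ++ cyclePairs w l))
    {c : (Fintype.card V).Partition → ℚ} (hc : IsStarExpansion G c)
    {lam : (Fintype.card V).Partition} (hlam : IsLeadingPartition c lam) :
    (2 ≤ (branching par U (l ++ [w]).toFinset).card →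
      lam.parts.card + (childless par U).card = Fintype.card V) ∧
    ((∀ v ∈ l, ∀ x ∈ U, par x ≠ v) →
      lam.parts.card + (childless par U).card + 1 = Fintype.card V) := by
  set B := Fintype.card V + 3 with hBdef
  set Lf := childless par U with hLf
  set Cy := (l ++ [w]).toFinset with hCy
  have hB : Fintype.card V < B := by omega
  have hmemU : ∀ {v}, v ∈ U ↔ v ∉ Cy := fun {v} => by rw [hU, Finset.mem_compl]
  have hLfU : Lf ⊆ U := fun u hu => (mem_childless.1 hu).1
  have hne : ∀ u ∈ U, par u ≠ u := fun u hu h => by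
    have := hpar u hu
    rw [h] at this
    exact lt_irrefl _ this
  have hcyc : ∀ e ∈ cyclePairs w l, e.1 ∈ Cy ∧ e.2 ∈ Cy := fun e he => by
    rw [hCy, List.mem_toFinset, List.mem_toFinset]
    exact mem_of_mem_cyclePairs he
  obtain ⟨c', hc', hsum⟩ := exists_starExpansion B hes
  obtain rfl := isStarExpansion_unique hc hc'
  have hw : (fun r : Setoid V => ∏ K ∈ blocks r, powerSumImage B K.card) =
      blockWeight (starFunctional B) fun _ : V => (X : ℚ[X][X]) :=
    funext fun r => (blockWeight_X B r).symm
  rw [hw, delContr_peel_leaves B hLfU hne (fun u hu => (mem_childless.1 hu).2)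
    fun u hu e he => ⟨fun h => hmemU.1 (hLfU hu) (h ▸ (hcyc e he).1),
      fun h => hmemU.1 (hLfU hu) (h ▸ (hcyc e he).2)⟩] at hsum
  obtain ⟨g, hg, happ⟩ := exists_delContr_factor (le_refl B) (childCount par Lf)
    (treePairs par (U \ Lf) ++ cyclePairs w l)
  rw [hsum] at hg
  have hmem : ∀ u ∈ U \ Lf, par u ∈ U \ Lf ∨ par u ∈ Cy := by
    intro u hu
    by_cases h : par u ∈ Cy
    · exact Or.inr h
    · refine Or.inl (Finset.mem_sdiff.2 ⟨hmemU.2 h, fun h' => ?_⟩)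
      exact (mem_childless.1 h').2 u (Finset.mem_sdiff.1 hu).1 rfl
  obtain ⟨z, hz, hz1, hzeq⟩ := exists_peel_core (par := par) (ht := ht) (L := childCount par Lf)
    (U₀ := U \ Lf) (Cy := Cy) (es := cyclePairs w l)
    (fun u hu => hpar u (Finset.mem_sdiff.1 hu).1)
    (Finset.disjoint_left.2 fun u hu => hmemU.1 (Finset.mem_sdiff.1 hu).1)
    (fun u hu h0 => by
      obtain ⟨h1, h2⟩ := Finset.mem_sdiff.1 hu
      have : ∃ x ∈ U, par x = u := by
        by_contra! h
        exact h2 (mem_childless.2 ⟨h1, h⟩)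
      obtain ⟨x, hx, hxu⟩ := this
      exact ⟨x, Finset.mem_sdiff.2 ⟨hx, fun h => childCount_eq_zero_iff.1 h0 x h hxu⟩, hxu⟩)
    hcyc (U \ Lf) subset_rfl hmem (fun v => leafWeight (childCount par Lf v))
    (fun v _ => by
      refine ⟨1, one_ne_zero, fun h => ?_, fun h => ?_, fun h _ => ?_⟩
      · simp [leafWeight, if_neg h, constPart, epsPart, epsWeight]
      · simp only [leafWeight, h, if_true]
        simp [constPart, epsPart, deepWeight, childCount]
      · simp only [leafWeight, if_pos h])
    (fun v hv => by
      have hvL : v ∈ Lf := by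
        by_contra h
        by_cases hvC : v ∈ Cy
        · exact hv (Finset.mem_union_right _ hvC)
        · exact hv (Finset.mem_union_left _ (Finset.mem_sdiff.2 ⟨hmemU.2 hvC, h⟩))
      rw [hLf, childCount_childless (hLf ▸ hvL), leafWeight, if_pos rfl, defFunctional_deepWeight])
  rw [hzeq, delContr_cyclePairs (S := DefBase) defFunctional defFunctional_deepWeight w l z hnd
    fun v hv => hz1 v (by rwa [hCy, List.mem_toFinset])] at happ
  set α : V → ℚ := fun v => if childCount par Lf v = 0 then childCount par (U \ Lf) v else 1 with hα
  set β : V → ℚ := fun v => if childCount par Lf v = 0 then 1 else 0 with hβ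
  have hα0 : ∀ v, 0 ≤ α v := fun v => by
    simp only [hα]
    split_ifs <;> positivity
  have hβ0 : ∀ v, 0 ≤ β v := fun v => by
    simp only [hβ]
    split_ifs <;> norm_num
  have hαβ : ∀ v, 0 < α v + β v := fun v => by
    simp only [hα, hβ]
    split_ifs <;> positivity
  have hγ : ∀ v, ∃ γ : ℚ, γ ≠ 0 ∧ (v ∈ Cy → constPart (z v) = - (γ * β v) ∧
      epsPart (z v) = γ * α v) := by
    intro v
    by_cases hv : v ∈ Cy
    · obtain ⟨a, ha, h1, h2, -⟩ := hz v hv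
      by_cases hL : childCount par Lf v = 0
      · refine ⟨-a, neg_ne_zero.2 ha, fun _ => ?_⟩
        simp only [hα, hβ, if_pos hL]
        rw [(h2 hL).1, (h2 hL).2]
        constructor <;> ring
      · refine ⟨a, ha, fun _ => ?_⟩
        simp only [hα, hβ, if_neg hL]
        rw [(h1 hL).1, (h1 hL).2]
        constructor <;> ring
    · exact ⟨1, one_ne_zero, fun h => absurd h hv⟩
  choose γ hγ0 hγz using hγ
  have hlist : ∀ v, v ∈ w :: l ↔ v ∈ Cy := fun v => by
    rw [hCy, List.mem_toFinset]
    simp [or_comm]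
  constructor
  · intro hbr
    have hcount : 2 ≤ (w :: l).countP (fun v => 0 < α v) := by
      have hnd' : (w :: l).Nodup := (List.perm_append_singleton w l).nodup_iff.1 hnd
      rw [List.countP_eq_length_filter, ← List.toFinset_card_of_nodup (hnd'.filter _)]
      refine hbr.trans (Finset.card_le_card fun v hv => ?_)
      obtain ⟨hv1, x, hx, hxv⟩ := mem_branching.1 hv
      rw [List.mem_toFinset, List.mem_filter, hlist]
      refine ⟨hv1, ?_⟩
      simp only [hα, decide_eq_true_eq]
      split_ifs with h
      · have : 0 < childCount par (U \ Lf) v := Finset.card_pos.2 ⟨x, Finset.mem_filter.2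
          ⟨Finset.mem_sdiff.2 ⟨hx, fun h' => childCount_eq_zero_iff.1 h x h' hxv⟩, hxv⟩⟩
        exact_mod_cast this
      · exact one_pos
    have hne0 := cycleValue_fst_ne_zero hα0 hβ0 hαβ hγ0
      (fun v hv => hγz v ((hlist v).1 hv)) hcount
    have hlead := isLeadingPartition_of_factor (i := 0) (lam := leafPartition par U) hB hg
      (by rwa [happ.coeff_zero (by omega)]) (fun j hj => absurd hj (Nat.not_lt_zero j))
      (partsWeight_leafPartition B par U)
    rw [isLeadingPartition_unique hlead hlam]
    exact card_leafPartition par U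
  · intro htriv
    have hL0 : ∀ v ∈ l, childCount par Lf v = 0 := fun v hv =>
      childCount_eq_zero_iff.2 fun x hx => htriv v hv x (hLfU hx)
    have hdeep : ∀ v ∈ l, z v = deepWeight := by
      intro v hv
      obtain ⟨a, -, -, -, h3⟩ := hz v ((hlist v).1 (List.mem_cons_of_mem _ hv))
      exact h3 (hL0 v hv) (childCount_eq_zero_iff.2 fun x hx =>
        htriv v hv x (Finset.mem_sdiff.1 hx).1)
    obtain ⟨h0, h1⟩ := cycleValue_of_single hlen (hα0 w) (hαβ w) (hγ0 w)
      (hγz w ((hlist w).1 List.mem_cons_self)) hdeep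
    obtain ⟨x, y, l', rfl⟩ : ∃ x y l', l = x :: y :: l' := by
      match l, hlen with
      | x :: y :: l', _ => exact ⟨x, y, l', rfl⟩
    have hxy : x ≠ y := by
      rintro rfl
      simp at hnd
    have hnot : ∀ v ∈ x :: y :: l', v ∉ childless par U := fun v hv h =>
      hmemU.1 (hLfU h) ((hlist v).1 (List.mem_cons_of_mem _ hv))
    obtain ⟨mu, hmu1, hmu2⟩ := exists_mergedPartition B hxy (hnot x (by simp)) (hnot y (by simp))
      (hL0 x (by simp)) (hL0 y (by simp))
    have hlead := isLeadingPartition_of_factor (i := B) (lam := mu) hB hg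
      (by rw [happ.coeff_self (by omega)]; exact neg_ne_zero.2 h1)
      (fun j hj => happ.coeff_eq_zero h0 hj) hmu1
    rw [isLeadingPartition_unique hlead hlam]
    exact hmu2

end LeadingPartition

section UnicyclicStructure

open SimpleGraph

variable {V : Type*} {G : SimpleGraph V}

theorem map_chainPairs_support {u v : V} (p : G.Walk u v) :
    (chainPairs p.support).map (fun e => s(e.1, e.2)) = p.edges := by
  induction p with
  | nil => rfl
  | @cons u v _ h q ih =>
    rw [Walk.support_cons, Walk.edges_cons, ← ih]
    conv_lhs => rw [← Walk.cons_tail_support q]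
    rw [chainPairs, Walk.cons_tail_support]
    rfl

theorem IsCycleSubgraph.connected {C : G.Subgraph} (hC : IsCycleSubgraph C) : C.Connected := by
  obtain ⟨u, p, -, rfl⟩ := hC
  exact p.toSubgraph_connected

theorem IsCycleSubgraph.ncard_neighborSet {C : G.Subgraph} (hC : IsCycleSubgraph C) {v : V}
    (hv : v ∈ C.verts) : (C.neighborSet v).ncard = 2 := by
  obtain ⟨u, p, hp, rfl⟩ := hC
  exact hp.ncard_neighborSet_toSubgraph_eq_two ((Walk.mem_verts_toSubgraph p).1 hv)

/-- A cycle listed from a prescribed vertex. -/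
theorem IsCycleSubgraph.exists_list {C : G.Subgraph} (hC : IsCycleSubgraph C) {w : V}
    (hw : w ∈ C.verts) : ∃ l : List V, (l ++ [w]).Nodup ∧ 2 ≤ l.length ∧
      (∀ v, v ∈ l ++ [w] ↔ v ∈ C.verts) ∧
      ∀ a b, C.Adj a b ↔ ∃ e ∈ cyclePairs w l, s(e.1, e.2) = s(a, b) := by
  classical
  obtain ⟨p, hp, hpC⟩ : ∃ p : G.Walk w w, p.IsCycle ∧ p.toSubgraph = C := by
    obtain ⟨u, p, hp, rfl⟩ := hC
    have hw' := (Walk.mem_verts_toSubgraph p).1 hw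
    exact ⟨p.rotate w hw', hp.rotate hw', Walk.toSubgraph_rotate p hw'⟩
  subst hpC
  cases p with
  | nil => exact absurd hp (by simp)
  | @cons _ v _ h q =>
    obtain ⟨hq, -⟩ := (Walk.cons_isCycle_iff q h).1 hp
    have hlen : 3 ≤ (Walk.cons h q).length := hp.isCircuit.three_le_length
    have hsupp : q.support.dropLast ++ [w] = q.support := by
      conv_rhs => rw [← List.dropLast_append_getLast q.support_ne_nil]
      rw [Walk.getLast_support]
    have hl : 2 ≤ q.support.dropLast.length := by
      rw [List.length_dropLast, Walk.length_support]
      rw [Walk.length_cons] at hlen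
      omega
    refine ⟨q.support.dropLast, ?_, hl, fun x => ?_, fun a b => ?_⟩
    · rw [hsupp]
      exact hq.support_nodup
    · rw [hsupp, Walk.mem_verts_toSubgraph, Walk.support_cons, List.mem_cons]
      refine ⟨Or.inr, ?_⟩
      rintro (rfl | hx)
      · exact q.end_mem_support
      · exact hx
    · have hcyc : cyclePairs w q.support.dropLast = (v, w) :: chainPairs q.support := by
        cases hd : q.support.dropLast with
        | nil =>
          rw [hd] at hl
          simp at hl
        | cons x l =>
          rw [hd, List.cons_append] at hsupp
          have hx : x = v := by
            have := hsupp.trans (Walk.cons_tail_support q).symm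
            exact (List.cons.inj this).1
          rw [cyclePairs, hsupp, hx]
      rw [hcyc, ← Subgraph.mem_edgeSet, Walk.mem_edges_toSubgraph, Walk.edges_cons,
        ← map_chainPairs_support, List.mem_cons, List.mem_map]
      simp only [List.mem_cons, or_and_right, exists_or, exists_eq_left]
      rw [Sym2.eq_swap (a := v) (b := w), eq_comm (a := s(w, v))]

/-- Edges outside the only cycle are bridges. -/
theorem isBridge_of_notMem_cycle {C : G.Subgraph} (huni : IsUnicyclic G) (hC : IsCycleSubgraph C)
    {a b : V} (hab : G.Adj a b) (hCab : ¬ C.Adj a b) : G.IsBridge s(a, b) := by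
  rw [isBridge_iff_forall_cycle_notMem (G.mem_edgeSet.2 hab)]
  intro u p hp he
  have : p.toSubgraph = C := huni.unique ⟨u, p, hp, rfl⟩ hC
  rw [← Walk.mem_edges_toSubgraph, this, Subgraph.mem_edgeSet] at he
  exact hCab he

theorem exists_parent (hconn : G.Connected) (w : V) : ∃ par : V → V, ∀ u, u ≠ w →
    G.Adj u (par u) ∧ G.dist (par u) w < G.dist u w := by
  have : ∀ u, ∃ v, u ≠ w → G.Adj u v ∧ G.dist v w < G.dist u w := by
    intro u
    obtain ⟨p, hp⟩ := (hconn u w).exists_walk_length_eq_dist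
    cases p with
    | nil => exact ⟨w, fun h => absurd rfl h⟩
    | @cons _ v _ h q =>
      refine ⟨v, fun _ => ⟨h, ?_⟩⟩
      have := dist_le q
      rw [← hp, Walk.length_cons]
      omega
  choose par hpar using this
  exact ⟨par, hpar⟩

/-- Every edge outside the cycle joins a vertex to its parent. -/
theorem adj_iff_cycle_or_parent {C : G.Subgraph} (huni : IsUnicyclic G)
    (hC : IsCycleSubgraph C) {w : V} (hw : w ∈ C.verts) {par : V → V}
    (hpar : ∀ u, u ≠ w → G.Adj u (par u) ∧ G.dist (par u) w < G.dist u w) (a b : V) :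
    G.Adj a b ↔ C.Adj a b ∨ (a ∉ C.verts ∧ b = par a) ∨ (b ∉ C.verts ∧ a = par b) := by
  have hne : ∀ {u}, u ∉ C.verts → u ≠ w := fun hu h => hu (h ▸ hw)
  constructor
  · intro hab
    by_contra! hcon
    obtain ⟨h1, h2, h3⟩ := hcon
    have hbr := isBridge_iff.1 (isBridge_of_notMem_cycle huni hC hab h1)
    have hadj : ∀ {x y}, G.Adj x y → s(x, y) ≠ s(a, b) →
        (G.deleteEdges {s(a, b)}).Adj x y := fun h h' => by
      rw [deleteEdges_adj]
      exact ⟨h, h'⟩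
    have key : ∀ n x, G.dist x w = n → (G.deleteEdges {s(a, b)}).Reachable x w := by
      intro n
      induction n using Nat.strong_induction_on with
      | _ n ih =>
        intro x hx
        by_cases hxC : x ∈ C.verts
        · let f : C.coe →g G.deleteEdges {s(a, b)} :=
            ⟨Subtype.val, fun {x y} hxy => hadj (C.adj_sub hxy) fun h => h1 (by
              rw [← Subgraph.mem_edgeSet, ← h]
              exact hxy)⟩
          exact (hC.connected.coe.preconnected ⟨x, hxC⟩ ⟨w, hw⟩).map f
        · obtain ⟨hp1, hp2⟩ := hpar x (hne hxC)
          refine (hadj hp1 fun h => ?_).reachable.trans (ih _ (hx ▸ hp2) _ rfl)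
          rcases Sym2.eq_iff.1 h with ⟨e₁, e₂⟩ | ⟨e₁, e₂⟩
          · exact h2 (e₁ ▸ hxC) (by rw [← e₁, ← e₂])
          · exact h3 (e₁ ▸ hxC) (by rw [← e₁, ← e₂])
    exact hbr ((key _ a rfl).trans (key _ b rfl).symm)
  · rintro (h | ⟨h, rfl⟩ | ⟨h, rfl⟩)
    · exact C.adj_sub h
    · exact (hpar a (hne h)).1
    · exact (hpar b (hne h)).1.symm

variable {C : G.Subgraph} {par : V → V} {U : Finset V}

theorem enumeratesEdges_of_adj_iff {w : V} {l : List V}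
    (hl : ∀ a b, C.Adj a b ↔ ∃ e ∈ cyclePairs w l, s(e.1, e.2) = s(a, b))
    (hU : ∀ v, v ∈ U ↔ v ∉ C.verts)
    (hadj : ∀ a b, G.Adj a b ↔
      C.Adj a b ∨ (a ∉ C.verts ∧ b = par a) ∨ (b ∉ C.verts ∧ a = par b)) :
    EnumeratesEdges G (treePairs par U ++ cyclePairs w l) := by
  intro κ
  constructor
  · intro h a b hab
    rcases (hadj a b).1 hab with h' | ⟨h', rfl⟩ | ⟨h', rfl⟩
    · obtain ⟨e, he, hs⟩ := (hl a b).1 h'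
      have := h e (List.mem_append_right _ he)
      rcases Sym2.eq_iff.1 hs with ⟨rfl, rfl⟩ | ⟨rfl, rfl⟩
      · exact this
      · exact this.symm
    · exact h (a, par a) (List.mem_append_left _ (mem_treePairs.2 ⟨(hU a).2 h', rfl⟩))
    · exact (h (b, par b) (List.mem_append_left _ (mem_treePairs.2 ⟨(hU b).2 h', rfl⟩))).symm
  · intro h e he
    refine h _ _ ((hadj _ _).2 ?_)
    rcases List.mem_append.1 he with he | he
    · obtain ⟨h1, h2⟩ := mem_treePairs.1 he
      exact Or.inr (Or.inl ⟨(hU _).1 h1, h2⟩)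
    · exact Or.inl ((hl _ _).2 ⟨e, he, rfl⟩)

theorem numLeaves_eq_card_childless [Fintype V] [DecidableEq V] (hC : IsCycleSubgraph C) (hU : ∀ v, v ∈ U ↔ v ∉ C.verts)
    {ht : V → ℕ} (hpar : ∀ u ∈ U, ht (par u) < ht u)
    (hadj : ∀ a b, G.Adj a b ↔
      C.Adj a b ∨ (a ∉ C.verts ∧ b = par a) ∨ (b ∉ C.verts ∧ a = par b)) :
    numLeaves G = (childless par U).card := by
  rw [numLeaves, ← Set.ncard_coe_finset]
  congr 1
  ext v
  rw [Set.mem_ofPred_eq, Finset.mem_coe, mem_childless]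
  by_cases hv : v ∈ C.verts
  · have h2 := hC.ncard_neighborSet hv
    have hle : (C.neighborSet v).ncard ≤ (G.neighborSet v).ncard :=
      Set.ncard_le_ncard (fun x hx => C.adj_sub hx) (Set.toFinite _)
    constructor
    · intro h
      omega
    · exact fun h => absurd hv ((hU v).1 h.1)
  · have hmem : ∀ x, x ∈ G.neighborSet v ↔ x = par v ∨ (x ∈ U ∧ par x = v) := by
      intro x
      rw [mem_neighborSet, hadj, hU]
      constructor
      · rintro (h | h | h)
        · exact absurd (C.edge_vert h) hv
        · exact Or.inl h.2
        · exact Or.inr ⟨h.1, h.2.symm⟩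
      · rintro (h | h)
        · exact Or.inr (Or.inl ⟨hv, h⟩)
        · exact Or.inr (Or.inr ⟨h.1, h.2.symm⟩)
    rw [Set.ncard_eq_one]
    constructor
    · rintro ⟨y, hy⟩
      refine ⟨(hU v).2 hv, fun x hx hxv => ?_⟩
      have h1 : par v ∈ ({y} : Set V) := hy ▸ (hmem _).2 (Or.inl rfl)
      have h2 : x ∈ ({y} : Set V) := hy ▸ (hmem _).2 (Or.inr ⟨hx, hxv⟩)
      have h3 : par v = x := (Set.mem_singleton_iff.1 h1).trans (Set.mem_singleton_iff.1 h2).symm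
      have h4 := hpar x hx
      have h5 := hpar v ((hU v).2 hv)
      rw [h3] at h5
      rw [hxv] at h4
      omega
    · rintro ⟨-, h⟩
      refine ⟨par v, Set.ext fun x => ?_⟩
      rw [hmem, Set.mem_singleton_iff]
      exact or_iff_left fun hx => h x hx.1 hx.2

theorem nontrivial_rootedTree_iff (hU : ∀ v, v ∈ U ↔ v ∉ C.verts)
    (hadj : ∀ a b, G.Adj a b ↔
      C.Adj a b ∨ (a ∉ C.verts ∧ b = par a) ∨ (b ∉ C.verts ∧ a = par b)) {v : V}
    (hv : v ∈ C.verts) : (rootedTreeVerts C v).Nontrivial ↔ ∃ x ∈ U, par x = v := by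
  constructor
  · intro h
    obtain ⟨y, hy, hyv⟩ := h.exists_ne v
    obtain ⟨p⟩ : (G.deleteEdges C.edgeSet).Reachable v y := hy
    cases p with
    | nil => exact absurd rfl hyv
    | @cons _ x _ hvx q =>
      rw [deleteEdges_adj, Subgraph.mem_edgeSet] at hvx
      rcases (hadj v x).1 hvx.1 with h | h | h
      · exact absurd h hvx.2
      · exact absurd hv h.1
      · exact ⟨x, (hU x).2 h.1, h.2.symm⟩
  · rintro ⟨x, hx, rfl⟩
    have hxC := (hU x).1 hx
    refine ⟨par x, Reachable.refl _, x, ?_, fun h => hxC (h ▸ hv)⟩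
    refine (show (G.deleteEdges C.edgeSet).Adj (par x) x from ?_).reachable
    rw [deleteEdges_adj, Subgraph.mem_edgeSet]
    exact ⟨(hadj _ _).2 (Or.inr (Or.inr ⟨hxC, rfl⟩)), fun h => hxC (C.edge_vert h.symm)⟩

end UnicyclicStructure

theorem mainTheorem11 {V : Type*} [Fintype V] (G : SimpleGraph V)
    (hconn : G.Connected) (huni : IsUnicyclic G)
    (C : G.Subgraph) (hC : IsCycleSubgraph C) :
    ∃ c : (Fintype.card V).Partition → ℚ,
      (IsStarExpansion G c ∧ ∀ c', IsStarExpansion G c' → c' = c) ∧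
      ∃ lam : (Fintype.card V).Partition,
        (IsLeadingPartition c lam ∧ ∀ lam', IsLeadingPartition c lam' → lam' = lam) ∧
        (numNontrivialTrees C = 1 →
          (numLeaves G : ℤ) = (lam.parts.sum : ℤ) - (lam.parts.card : ℤ) - 1) ∧
        (2 ≤ numNontrivialTrees C →
          (numLeaves G : ℤ) = (lam.parts.sum : ℤ) - (lam.parts.card : ℤ)) := by
  classical
  obtain ⟨w, hw, hw1⟩ : ∃ w ∈ C.verts, numNontrivialTrees C = 1 →
      ∀ v ∈ C.verts, (rootedTreeVerts C v).Nontrivial → v = w := by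
    by_cases h : numNontrivialTrees C = 1
    · obtain ⟨w, hw⟩ := Set.ncard_eq_one.1 h
      have hw' : w ∈ {v ∈ C.verts | (rootedTreeVerts C v).Nontrivial} := hw ▸ rfl
      exact ⟨w, hw'.1, fun _ v hv hv' => Set.mem_singleton_iff.1 (hw ▸ ⟨hv, hv'⟩)⟩
    · obtain ⟨u, p, hp, rfl⟩ := hC
      exact ⟨u, p.start_mem_verts_toSubgraph, fun h' => absurd h' h⟩
  obtain ⟨l, hnd, hlen, hverts, hedges⟩ := hC.exists_list hw
  obtain ⟨par, hpar⟩ := exists_parent hconn w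
  have hadj := adj_iff_cycle_or_parent huni hC hw hpar
  set U : Finset V := (l ++ [w]).toFinsetᶜ with hUdef
  have hU : ∀ v, v ∈ U ↔ v ∉ C.verts := fun v => by
    rw [hUdef, Finset.mem_compl, List.mem_toFinset, hverts]
  have hht : ∀ u ∈ U, G.dist (par u) w < G.dist u w := fun u hu =>
    (hpar u fun h => (hU u).1 hu (h ▸ hw)).2
  have hes := enumeratesEdges_of_adj_iff hedges hU hadj
  obtain ⟨c, hc, -⟩ := exists_starExpansion 0 hes
  have hc0 : c ≠ 0 := by
    rintro rfl
    refine chromaticSymm_ne_zero G (Eq.trans hc ?_)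
    simp
  obtain ⟨lam, hlam⟩ := exists_isLeadingPartition hc0
  obtain ⟨hcase₂, hcase₁⟩ :=
    card_parts_leadingPartition (ht := fun u => G.dist u w) hnd hlen hUdef hht hes hc hlam
  have hleaves := numLeaves_eq_card_childless (ht := fun u => G.dist u w) hC hU hht hadj
  have hnum : numNontrivialTrees C = (branching par U (l ++ [w]).toFinset).card := by
    rw [numNontrivialTrees, ← Set.ncard_coe_finset]
    congr 1
    ext v
    rw [Set.mem_ofPred_eq, Finset.mem_coe, mem_branching, List.mem_toFinset, hverts]
    exact and_congr_right fun hv => nontrivial_rootedTree_iff hU hadj hv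
  refine ⟨c, ⟨hc, fun c' => isStarExpansion_unique hc⟩, lam,
    ⟨hlam, fun lam' => isLeadingPartition_unique hlam⟩, fun h => ?_, fun h => ?_⟩
  · have := hcase₁ fun v hv x hx hxv => by
      have hvC := (hverts v).1 (List.mem_append_left _ hv)
      have hvw := hw1 h v hvC ((nontrivial_rootedTree_iff hU hadj hvC).2 ⟨x, hx, hxv⟩)
      exact (List.nodup_append.1 hnd).2.2 v hv w (by simp) hvw
    rw [hleaves, lam.parts_sum]
    omega
  · have := hcase₂ (hnum ▸ h)
    rw [hleaves, lam.parts_sum]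
    omega
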